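/- **Conventions.** Let $S_+$ be the group of permutations of $\mathbb Z$ that move only finitely many integers, all of them positive. Let $s_i$ be the transposition $(i\leftrightarrow i+1)$, and let $\mathrm{Red}(w)$ be the set of reduced words of $w$, that is, the words $i_1\cdots i_k$ of minimal length with $s_{i_1}\cdots s_{i_k}=w$. For a word $\mathbf i=i_1\cdots i_k$ in $\mathbb Z$ let $\mathfrak F(\mathbf i)=\sum x_{a_1}\cdots x_{a_k}$, summed over all integer sequences $a_1\ge\cdots\ge a_k$ with $1\le a_j\le i_j$ for all $j$, and $a_j>a_{j+1}$ whenever $i_j>i_{j+1}$. The Schubert polynomial of $w\in S_+$ is $\mathfrak S_w=\sum_{\mathbf i\in \mathrm{Red}(w^{-1})}\mathfrak F(\mathbf i)$. **Forest polynomials.** An indexed forest $F$ consists of a finite set $S\subset\mathbb Z$ (its support) and, for each maximal interval $I$ of consecutive integers in $S$, a plane binary tree with $|I|$ internal nodes, which are identified with the elements of $I$ in inorder (canonical labels). For an internal node $v$ let $\rho_F(v)$ be the canonical label of the node reached from $v$ by following left edges down. For any integer-valued function $\rho$ on the internal nodes let $\mathfrak P(F,\rho)=\sum_\kappa\prod_v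 x_{\kappa(v)}$, where $\kappa$ ranges over the labelings of the internal nodes $v$ by integers $1\le\kappa(v)\le\rho(v)$ that increase weakly down left edges and strictly down right edges. The forest polynomial of $F$ is $\mathfrak P_F=\mathfrak P(F,\rho_F)$. (It is $1$ if $F$ is empty and $0$ if $S\not\subset\mathbb Z_{\ge1}$.) **Insertion.** Consider letters $i^{(j)}$ ($i\in\mathbb Z$, $j\ge1$), ordered lexicographically, with $\mathrm{val}(i^{(j)})=i$. The $P$-symbol $P(W)$ of a word $W$ with pairwise distinct letters is the indexed forest with nodes labeled by the letters of $W$ that is obtained from the empty forest by inserting the letters from left to right. A letter $a$ is inserted in a forest with support $S'$ by creating a new root labeled $a$ at a canonical label $m\notin S'$: $m=\mathrm{val}(a)$ if $\mathrm{val}(a)\notin S'$; if $\mathrm{val}(a)$ lies in a maximal interval $I$ of $S'$ and $b$ is the label of the root of the tree on $I$, then $m=\max I+1$ if $a>b$ and $m=\min I-1$ if $a<b$. The left (right) subtree of the new root is the tree on the maximal interval of $S'$ that ends at $m-1$ (begins at $m+1$), and is empty if there is no such interval. Write $W\equiv_\Omega W'$ if $P(W)=P(W')$. To a $\equiv_\Omega$-class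 $\mathcal C$ with common $P$-symbol $P$, of underlying indexed forest $F(\mathcal C)$, attach $\mathfrak P(\mathcal C)=\mathfrak P(F(\mathcal C),\rho)$, where $\rho(v)$ is the value of the label of $v$ in $P$. A word in $\mathbb Z$ is regarded as a word with distinct letters by replacing the occurrences of $i$, from left to right, by $i^{(1)},i^{(2)},\dots$. **Theorem 1.3.** Let $w\in S_+$. Then $\mathrm{Red}(w^{-1})$ is finite, and it is a union of $\equiv_\Omega$-classes (classes of the equivalence relation on the set of all words with distinct letters). Let $\mathcal G_w$ be the set of these classes. Then $$\mathfrak S_w=\sum_{\mathcal C\in\mathcal G_w}\mathfrak P(\mathcal C),$$ and $\mathfrak P(\mathcal C)=\mathfrak P_{F(\mathcal C)}$ for every $\mathcal C\in\mathcal G_w$. Hence $\mathfrak S_w$ is a linear combination, with nonnegative integer coefficients, of forest polynomials $\mathfrak P_F$ of indexed forests $F$ with support in $\mathbb Z_{\ge1}$. -/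

import Mathlib

namespace ForestSchubert

/-! ### Permutations, reduced words, slide polynomials, Schubert polynomials

Polynomials live in `MvPolynomial ℤ ℚ`, the ring `ℚ[x_i : i ∈ ℤ]`; all the polynomials below
only use the variables `x_i` with `i ≥ 1`. -/

/-- `S_+`: the permutations of `ℤ` that move only finitely many integers, all of them positive. -/
def SPlus : Set (Equiv.Perm ℤ) :=
  {w | {i : ℤ | w i ≠ i}.Finite ∧ ∀ i : ℤ, w i ≠ i → 1 ≤ i}

/-- The product `s_{i_1} ⋯ s_{i_k}` of adjacent transpositions `s_i = (i ↔ i + 1)`. -/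
def wordProd (i : List ℤ) : Equiv.Perm ℤ :=
  (i.map fun j => Equiv.swap j (j + 1)).prod

/-- `Red(w)`: the words of minimal length among those with product `w`. -/
def Red (w : Equiv.Perm ℤ) : Set (List ℤ) :=
  {i | wordProd i = w ∧ ∀ j : List ℤ, wordProd j = w → i.length ≤ j.length}

open Classical in
/-- The sequences `a_1 ≥ ⋯ ≥ a_k` compatible with the word `i_1 ⋯ i_k`: one has `1 ≤ a_j ≤ i_j`,
and `a_j > a_{j+1}` whenever `i_j > i_{j+1}`. -/
noncomputable def compatible (i : List ℤ) : Finset (Fin i.length → ℤ) :=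
  (Fintype.piFinset fun j : Fin i.length => Finset.Icc 1 (i.get j)).filter fun a =>
    ∀ (j : ℕ) (h : j + 1 < i.length),
      a ⟨j + 1, h⟩ ≤ a ⟨j, Nat.lt_of_succ_lt h⟩ ∧
      (i.get ⟨j + 1, h⟩ < i.get ⟨j, Nat.lt_of_succ_lt h⟩ →
        a ⟨j + 1, h⟩ < a ⟨j, Nat.lt_of_succ_lt h⟩)

/-- The slide polynomial of a word. -/
noncomputable def slide (i : List ℤ) : MvPolynomial ℤ ℚ :=
  ∑ a ∈ compatible i, ∏ j, MvPolynomial.X (a j)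

/-- The Schubert polynomial of `w ∈ S_+` (Billey–Jockusch–Stanley); the set `Red(w⁻¹)` is finite. -/
noncomputable def schubert (w : Equiv.Perm ℤ) : MvPolynomial ℤ ℚ :=
  ∑ᶠ i ∈ Red w⁻¹, slide i

/-! ### Indexed forests -/

/-- The internal nodes of a binary tree. In a tree with left subtree `l` and right subtree `r`,
`none` is the root, `some (inl v)` is the node `v` of `l` and `some (inr v)` the node `v` of `r`. -/
def Nodes {α : Type} : BinaryTree α → Type
  | .nil => Empty
  | .node _ l r => Option (Nodes l ⊕ Nodes r)

instance nodesFintype {α : Type} : (T : BinaryTree α) → Fintype (Nodes T)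
  | .nil => inferInstanceAs (Fintype Empty)
  | .node _ l r =>
      haveI := nodesFintype l
      haveI := nodesFintype r
      inferInstanceAs (Fintype (Option (Nodes l ⊕ Nodes r)))

instance nodesDecidableEq {α : Type} : (T : BinaryTree α) → DecidableEq (Nodes T)
  | .nil => inferInstanceAs (DecidableEq Empty)
  | .node _ l r =>
      haveI := nodesDecidableEq l
      haveI := nodesDecidableEq r
      inferInstanceAs (DecidableEq (Option (Nodes l ⊕ Nodes r)))

/-- The label carried by a node. -/
def label {α : Type} : (T : BinaryTree α) → Nodes T → α
  | .node a _ _, none => a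
  | .node _ l _, some (.inl v) => label l v
  | .node _ _ r, some (.inr v) => label r v

/-- `v` is the root of the tree `T`. -/
def IsRoot {α : Type} : (T : BinaryTree α) → Nodes T → Prop
  | .node _ _ _, v => v = none

/-- The canonical labeling of a tree supported on `{s, s + 1, …, s + |T| - 1}`: the nodes
are labeled by these integers in inorder. -/
def can {α : Type} (s : ℤ) : (T : BinaryTree α) → Nodes T → ℤ
  | .node _ l _, none => s + l.numNodes
  | .node _ l _, some (.inl v) => can s l v
  | .node _ l r, some (.inr v) => can (s + l.numNodes + 1) r v

/-- The last node reached from a node by following left edges down. -/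
def descendLeft {α : Type} : (T : BinaryTree α) → Nodes T → Nodes T
  | .node _ .nil _, none => none
  | .node _ (.node b l r) _, none => some (.inl (descendLeft (.node b l r) none))
  | .node _ l _, some (.inl v) => some (.inl (descendLeft l v))
  | .node _ _ r, some (.inr v) => some (.inr (descendLeft r v))

/-- A forest is encoded by the list of its trees from left to right, each tree `T` coming with the
least element `s` of its support, which is the interval `{s, …, s + |T| - 1}`.
The nodes carry labels in `α`; take `α = Unit` for no labels. -/
abbrev Forest (α : Type) : Type := List (ℤ × BinaryTree α)

/-- The condition for a list of trees with intervals to be an indexed forest: no tree is empty,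
and the intervals are listed from left to right with a gap between any two of them. So these
intervals are the maximal intervals of the support of the forest. -/
def IsIndexedForest {α : Type} (F : Forest α) : Prop :=
  (∀ p ∈ F, p.2 ≠ .nil) ∧ F.Pairwise fun p q => p.1 + (p.2.numNodes : ℤ) < q.1

/-- Indexed forests. -/
def IndexedForest : Type := {F : Forest Unit // IsIndexedForest F}

/-- The support of an indexed forest consists of positive integers. -/
def IndexedForest.IsPositive (F : IndexedForest) : Prop := ∀ p ∈ F.1, 1 ≤ p.1

/-- The set `IN(F)` of internal nodes of a forest. -/
abbrev InternalNodes {α : Type} (F : Forest α) : Type :=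
  Σ k : Fin F.length, Nodes (F.get k).2

/-- The underlying unlabeled forest. -/
def Forest.shape {α : Type} (F : Forest α) : Forest Unit :=
  F.map fun p => (p.1, p.2.map fun _ => ())

/-- `ρ_F(v)`: the canonical label of the node reached by following left edges down from `v`. -/
def rho {α : Type} (F : Forest α) (v : InternalNodes F) : ℤ :=
  can (F.get v.1).1 (F.get v.1).2 (descendLeft (F.get v.1).2 v.2)

/-! ### Forest polynomials -/

/-- The labeling `κ` of a binary tree increases weakly down left edges and strictly down right
edges. -/
def IsFlagged {α : Type} : (T : BinaryTree α) → (Nodes T → ℤ) → Prop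
  | .nil, _ => True
  | .node _ l r, κ =>
      (∀ v, IsRoot l v → κ none ≤ κ (some (.inl v))) ∧
      (∀ v, IsRoot r v → κ none < κ (some (.inr v))) ∧
      IsFlagged l (fun v => κ (some (.inl v))) ∧
      IsFlagged r (fun v => κ (some (.inr v)))

open Classical in
/-- The sum of `∏_v x_{κ(v)}` over all `κ : IN(F) → ℤ_{≥ 1}` bounded above by `ρ`, weakly
increasing down left edges and strictly increasing down right edges. -/
noncomputable def flaggedPoly {α : Type} (F : Forest α) (ρ : InternalNodes F → ℤ) :
    MvPolynomial ℤ ℚ :=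
  ∑ κ ∈ (Fintype.piFinset fun v : InternalNodes F => Finset.Icc 1 (ρ v)).filter
      (fun κ => ∀ k : Fin F.length, IsFlagged (F.get k).2 fun v => κ ⟨k, v⟩),
    ∏ v, MvPolynomial.X (κ v)

/-- The forest polynomial of an indexed forest. -/
noncomputable def forestPoly (F : Forest Unit) : MvPolynomial ℤ ℚ := flaggedPoly F (rho F)

/-! ### Words with distinct letters, insertion, and the equivalence -/

/-- The letters `i^{(j)}` with `i ∈ ℤ` and `j ≥ 1`, ordered lexicographically. -/
abbrev Letter : Type := ℤ ×ₗ ℕ+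

/-- The value `i` of the letter `i^{(j)}`. -/
def val (a : Letter) : ℤ := (ofLex a).1

/-- The canonical label of the node that is created when `a` is inserted in `P`: it is `val a` if
this is not in the support of `P`. If `val a` lies in the interval of a tree with root label `b`,
the new node is placed just right of this interval when `b < a` and just left of it otherwise. -/
def newPosition (a : Letter) (P : Forest Letter) : ℤ :=
  match P.find? fun p => decide (p.1 ≤ val a ∧ val a < p.1 + p.2.numNodes) with
  | some (s, .node b l r) =>
      if b < a then s + (BinaryTree.node b l r).numNodes else s - 1
  | _ => val a

/-- Insertion of `a` in `P`: a new root labeled `a` is created at canonical label `m`. Its left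
subtree is the tree of `P` whose interval ends at `m - 1`, if there is one, and its right
subtree is the tree of `P` whose interval starts at `m + 1`, if there is one. -/
def insertLetter (P : Forest Letter) (a : Letter) : Forest Letter :=
  let m := newPosition a P
  let L := ((P.find? fun p => decide (p.1 + p.2.numNodes = m)).map Prod.snd).getD .nil
  let R := ((P.find? fun p => decide (p.1 = m + 1)).map Prod.snd).getD .nil
  (P.filter fun p => decide (p.1 + p.2.numNodes < m)) ++
    (m - L.numNodes, .node a L R) :: P.filter fun p => decide (m + 1 < p.1)

/-- Words with pairwise distinct letters. -/
def InjWord : Type := {W : List Letter // W.Nodup}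

/-- The `P`-symbol of a word: its letters are inserted from left to right in the empty forest. -/
def pSymbol (W : InjWord) : Forest Letter := W.1.foldl insertLetter []

/-- The equivalence of words: their `P`-symbols agree. -/
def omegaSetoid : Setoid InjWord := Setoid.ker pSymbol

/-- The equivalence classes of words with distinct letters. -/
abbrev OmegaClass : Type := Quotient omegaSetoid

/-- The common `P`-symbol of the words in a class. -/
def OmegaClass.symbol (C : OmegaClass) : Forest Letter :=
  Quotient.lift (s := omegaSetoid) pSymbol (fun _ _ h => h) C

/-- The words in a class. -/
def OmegaClass.words (C : OmegaClass) : Set InjWord := {W | Quotient.mk omegaSetoid W = C}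

/-- The polynomial attached to a class with `P`-symbol `P`: as for forest polynomials, with the
upper bounds on `κ` given by the labels of the nodes in `P`. (A bound `κ(v) ≤ i^{(j)}` means
`κ(v) ≤ i`.) -/
noncomputable def OmegaClass.poly (C : OmegaClass) : MvPolynomial ℤ ℚ :=
  flaggedPoly C.symbol fun v => val (label (C.symbol.get v.1).2 v.2)

/-! ### Reduced words as words with distinct letters -/

/-- Relabeling of a word whose letters come after those in `pre`. -/
def relabelAux : List ℤ → List ℤ → List Letter
  | _, [] => []
  | pre, i :: w => toLex (i, (pre.count i).succPNat) :: relabelAux (i :: pre) w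

theorem lt_of_mem_relabelAux (w pre : List ℤ) :
    ∀ a ∈ relabelAux pre w, pre.count (val a) < ((ofLex a).2 : ℕ) := by
  induction w generalizing pre with
  | nil => simp [relabelAux]
  | cons i w ih =>
    intro a ha
    rcases List.mem_cons.1 ha with rfl | ha
    · simp [val]
    · exact lt_of_le_of_lt (List.count_le_count_cons) (ih (i :: pre) a ha)

theorem nodup_relabelAux (w pre : List ℤ) : (relabelAux pre w).Nodup := by
  induction w generalizing pre with
  | nil => simp [relabelAux]
  | cons i w ih =>
    refine List.nodup_cons.2 ⟨fun h => ?_, ih _⟩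
    have := lt_of_mem_relabelAux w (i :: pre) _ h
    simp [val] at this

/-- The occurrences of the letter `i` are replaced by `i^{(1)}, i^{(2)}, …` from left to right. -/
def relabel (i : List ℤ) : InjWord := ⟨relabelAux [] i, nodup_relabelAux i []⟩

/-- `Red(w)`, viewed as a set of words with distinct letters. -/
def RedInj (w : Equiv.Perm ℤ) : Set InjWord := relabel '' Red w

/-- `𝒢_w`: the set of the equivalence classes of the elements of `Red(w⁻¹)`. -/
def classesOf (w : Equiv.Perm ℤ) : Set OmegaClass :=
  Quotient.mk omegaSetoid '' RedInj w⁻¹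

end ForestSchubert

/-!
A `P`-symbol is a labeled indexed forest in which every node sits where insertion of its label would
put it, relative to the trees that become its subtrees (`IsSymbol`); this forces the labels to
increase from the left child to the parent, and from there to the right child. Since the condition
on a node only involves its subtrees, the last letter of a word with symbol `P` can be any root of
`P`, and by induction the class of `P` consists of the linear extensions of `P`: the arrangements of
its labels in which children come before their parents (`foldl_insertLetter`,
`foldl_insertLetter_eq`).

The polynomial of a class is then a sum of slide polynomials by the fundamental theorem of
`P`-partitions (`OmegaClass.poly_eq`). Given a function on the labels, there is exactly one word
sorted by decreasing values, ties being broken by the order of the letters, and it is a linear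
extension of `P` if and only if the function is a flagged labeling of `P`.

Letters in different trees of a symbol have values that differ by at least two. So two words with the
same symbol have the same product and show the letters of any given value in the same order, as the
comparison of a word with the postorder reading of its symbol makes precise. This gives that
reduced words are closed under the equivalence (`mem_redInj_of_pSymbol_eq`), and the expansion of
the Schubert polynomial follows by grouping reduced words into classes.

Finally, the bounds given by the labels and those defining the forest polynomial admit the same
flagged labelings (`flaggedPoly_val_eq`): the value of a label is at least the least element of the
interval of its subtree, and conversely a flagged labeling bounded by the values is bounded by these
least elements, by induction from the leaves (`le_can_descendLeft`). A forest polynomial vanishes if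
the support of the forest is not positive, so those classes can be dropped.
-/

namespace ForestSchubert

/-! ### Valid labelings of forests -/

/-- The root of the tree satisfies `p`; vacuous for the empty tree. -/
def RootAll (p : Letter → Prop) : BinaryTree Letter → Prop
  | .nil => True
  | .node b _ _ => p b

/-- The condition under which insertion of `a` creates its node at `m`, with subtrees `L` and `R`
supported on the intervals that end at `m - 1` and begin at `m + 1`. -/
def NodeCondition (a : Letter) (m : ℤ) (L R : BinaryTree Letter) : Prop :=
  val a = m ∨
  (m - L.numNodes ≤ val a ∧ val a < m ∧ RootAll (· < a) L) ∨
  (m < val a ∧ val a ≤ m + R.numNodes ∧ RootAll (a < ·) R)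

/-- Every node of the tree, supported on an interval starting at `s`, is where insertion of its
label puts it. -/
def IsValid : ℤ → BinaryTree Letter → Prop
  | _, .nil => True
  | s, .node a L R =>
      IsValid s L ∧ IsValid (s + L.numNodes + 1) R ∧ NodeCondition a (s + L.numNodes) L R

/-- The labeled indexed forests all of whose nodes are where insertion puts them. Those with
pairwise distinct labels are exactly the `P`-symbols. -/
def IsSymbol (P : Forest Letter) : Prop :=
  IsIndexedForest P ∧ ∀ p ∈ P, IsValid p.1 p.2

/-- The forest made of one tree, which is empty if the tree is. -/
def piece (s : ℤ) : BinaryTree Letter → Forest Letter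
  | .nil => []
  | .node a L R => [(s, .node a L R)]

/-- The labels of a tree in postorder. -/
def postorder : BinaryTree Letter → List Letter
  | .nil => []
  | .node a L R => postorder L ++ postorder R ++ [a]

/-- The labels of a forest, each tree being read in postorder. -/
def reading (P : Forest Letter) : List Letter := P.flatMap fun p => postorder p.2

/-- Every child `c` of a node `a` satisfies `r c a`. -/
def TreeRel (r : Letter → Letter → Prop) : BinaryTree Letter → Prop
  | .nil => True
  | .node a L R => RootAll (r · a) L ∧ RootAll (r · a) R ∧ TreeRel r L ∧ TreeRel r R

/-- Every child `c` of a node `a` satisfies `r c a`. -/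
def ForestRel (r : Letter → Letter → Prop) (P : Forest Letter) : Prop :=
  ∀ p ∈ P, TreeRel r p.2

theorem RootAll.imp {p q : Letter → Prop} {T : BinaryTree Letter} (h : RootAll p T)
    (hpq : ∀ b ∈ postorder T, p b → q b) : RootAll q T := by
  cases T with
  | nil => trivial
  | node b l r => exact hpq b (by simp [postorder]) h

@[simp] theorem mem_piece {s : ℤ} {T : BinaryTree Letter} {p : ℤ × BinaryTree Letter} :
    p ∈ piece s T ↔ T ≠ .nil ∧ p = (s, T) := by
  cases T <;> simp [piece]

@[simp] theorem reading_piece (s : ℤ) (T : BinaryTree Letter) :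
    reading (piece s T) = postorder T := by
  cases T <;> simp [piece, reading, postorder]

@[simp] theorem reading_append (P Q : Forest Letter) :
    reading (P ++ Q) = reading P ++ reading Q := by
  simp [reading]

@[simp] theorem reading_cons (s : ℤ) (T : BinaryTree Letter) (Q : Forest Letter) :
    reading ((s, T) :: Q) = postorder T ++ reading Q := by
  simp [reading]

theorem pairwise_piece (s : ℤ) (T : BinaryTree Letter)
    (r : ℤ × BinaryTree Letter → ℤ × BinaryTree Letter → Prop) : (piece s T).Pairwise r := by
  cases T <;> simp [piece]

theorem IsValid.val_root {s : ℤ} {a : Letter} {L R : BinaryTree Letter}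
    (h : IsValid s (.node a L R)) :
    s ≤ val a ∧ val a < s + (BinaryTree.node a L R).numNodes := by
  obtain ⟨-, -, h⟩ := h
  simp only [BinaryTree.numNodes]
  push_cast
  rcases h with h | ⟨h, h', -⟩ | ⟨h, h', -⟩ <;> constructor <;> omega

theorem IsValid.val_mem {s : ℤ} {T : BinaryTree Letter} (h : IsValid s T) :
    ∀ b ∈ postorder T, s ≤ val b ∧ val b < s + T.numNodes := by
  induction T generalizing s with
  | nil => simp [postorder]
  | node a L R ihL ihR =>
    intro b hb
    have hr := h.val_root
    simp only [postorder, List.mem_append, List.mem_singleton] at hb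
    simp only [BinaryTree.numNodes] at hr ⊢
    push_cast at hr ⊢
    rcases hb with (hb | hb) | rfl
    · have := ihL h.1 b hb
      omega
    · have := ihR h.2.1 b hb
      omega
    · exact hr

theorem rootAll_val_lt {s m : ℤ} {T : BinaryTree Letter} (h : IsValid s T)
    (hm : s + T.numNodes ≤ m) : RootAll (val · < m) T := by
  cases T with
  | nil => trivial
  | node b l r => exact h.val_root.2.trans_le hm

theorem rootAll_lt_val {s m : ℤ} {T : BinaryTree Letter} (h : IsValid s T)
    (hm : m < s) : RootAll (m < val ·) T := by
  cases T with
  | nil => trivial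
  | node b l r => exact hm.trans_le h.val_root.1

theorem lt_of_val_lt {a b : Letter} (h : val a < val b) : a < b :=
  Prod.Lex.lt_iff.2 (Or.inl h)

/-- A valid labeling is increasing from the left child of a node to the node, and from there to
its right child. -/
theorem IsValid.rootAll_lt {s : ℤ} {a : Letter} {L R : BinaryTree Letter}
    (h : IsValid s (.node a L R)) : RootAll (· < a) L ∧ RootAll (a < ·) R := by
  obtain ⟨hL, hR, h⟩ := h
  have h1 := rootAll_val_lt hL le_rfl
  have h2 := rootAll_lt_val hR (lt_add_one _)
  rcases h with h | ⟨-, h, h'⟩ | ⟨h, -, h'⟩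
  · exact ⟨h1.imp fun b _ hb => lt_of_val_lt (hb.trans_eq h.symm),
      h2.imp fun b _ hb => lt_of_val_lt (h.trans_lt hb)⟩
  · exact ⟨h', h2.imp fun b _ hb => lt_of_val_lt (h.trans hb)⟩
  · exact ⟨h1.imp fun b _ hb => lt_of_val_lt (hb.trans h), h'⟩

/-! ### The effect of an insertion -/

theorem IsIndexedForest.trichotomy {P : Forest Letter} (hPP : IsIndexedForest P)
    {p q : ℤ × BinaryTree Letter} (hp : p ∈ P) (hq : q ∈ P) :
    p = q ∨ p.1 + p.2.numNodes < q.1 ∨ q.1 + q.2.numNodes < p.1 := by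
  replace hP := hPP.2
  clear hPP
  induction P with
  | nil => simp at hp
  | cons x P ih =>
    rw [List.pairwise_cons] at hP
    rcases List.mem_cons.1 hp with rfl | hp' <;> rcases List.mem_cons.1 hq with rfl | hq'
    · exact Or.inl rfl
    · exact Or.inr (Or.inl (hP.1 _ hq'))
    · exact Or.inr (Or.inr (hP.1 _ hp'))
    · exact ih hp' hq' hP.2

theorem IsIndexedForest.find?_eq {P : Forest Letter} (hP : IsIndexedForest P)
    {p : ℤ × BinaryTree Letter} (hp : p ∈ P) {x : ℤ} (h : p.1 ≤ x ∧ x < p.1 + p.2.numNodes) :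
    P.find? (fun p => decide (p.1 ≤ x ∧ x < p.1 + p.2.numNodes)) = some p := by
  cases hf : P.find? (fun p => decide (p.1 ≤ x ∧ x < p.1 + p.2.numNodes)) with
  | none => exact absurd h (by simpa using List.find?_eq_none.1 hf p hp)
  | some q =>
    have h1 := List.mem_of_find?_eq_some hf
    have h2 := List.find?_some hf
    simp only [decide_eq_true_eq] at h2
    rcases hP.trichotomy hp h1 with rfl | h3 | h3
    · rfl
    · omega
    · omega

/-- If `a` is inserted at `m`, the trees `L` and `R` that end at `m - 1` and begin at `m + 1` become
the subtrees of the new root. -/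
theorem insertLetter_eq {X Y : Forest Letter} {L R : BinaryTree Letter} {m : ℤ} {a : Letter}
    (hX : ∀ p ∈ X, p.1 + (p.2.numNodes : ℤ) < m) (hY : ∀ p ∈ Y, m + 1 < p.1)
    (hm : newPosition a (X ++ (piece (m - L.numNodes) L ++ (piece (m + 1) R ++ Y))) = m) :
    insertLetter (X ++ (piece (m - L.numNodes) L ++ (piece (m + 1) R ++ Y))) a =
      X ++ (m - (L.numNodes : ℤ), .node a L R) :: Y := by
  have f1 : (X ++ (piece (m - L.numNodes) L ++ (piece (m + 1) R ++ Y))).filter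
      (fun p => decide (p.1 + (p.2.numNodes : ℤ) < m)) = X := by
    have h1 : X.filter (fun p => decide (p.1 + (p.2.numNodes : ℤ) < m)) = X :=
      List.filter_eq_self.2 fun p hp => decide_eq_true (hX p hp)
    have h2 : (piece (m - L.numNodes) L).filter
        (fun p => decide (p.1 + (p.2.numNodes : ℤ) < m)) = [] :=
      List.filter_eq_nil_iff.2 fun p hp => by
        obtain ⟨-, rfl⟩ := mem_piece.1 hp
        simp
    have h3 : (piece (m + 1) R).filter
        (fun p => decide (p.1 + (p.2.numNodes : ℤ) < m)) = [] :=
      List.filter_eq_nil_iff.2 fun p hp => by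
        obtain ⟨-, rfl⟩ := mem_piece.1 hp
        simp only [decide_eq_true_eq]
        omega
    have h4 : Y.filter (fun p => decide (p.1 + (p.2.numNodes : ℤ) < m)) = [] :=
      List.filter_eq_nil_iff.2 fun p hp => by
        have := hY p hp
        simp only [decide_eq_true_eq]
        omega
    simp [List.filter_append, h1, h2, h3, h4]
  have f2 : (X ++ (piece (m - L.numNodes) L ++ (piece (m + 1) R ++ Y))).filter
      (fun p => decide (m + 1 < p.1)) = Y := by
    have h1 : X.filter (fun p => decide (m + 1 < p.1)) = [] :=
      List.filter_eq_nil_iff.2 fun p hp => by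
        have := hX p hp
        simp only [decide_eq_true_eq]
        omega
    have h2 : (piece (m - L.numNodes) L).filter (fun p => decide (m + 1 < p.1)) = [] :=
      List.filter_eq_nil_iff.2 fun p hp => by
        obtain ⟨-, rfl⟩ := mem_piece.1 hp
        simp only [decide_eq_true_eq]
        omega
    have h3 : (piece (m + 1) R).filter (fun p => decide (m + 1 < p.1)) = [] :=
      List.filter_eq_nil_iff.2 fun p hp => by
        obtain ⟨-, rfl⟩ := mem_piece.1 hp
        simp
    have h4 : Y.filter (fun p => decide (m + 1 < p.1)) = Y :=
      List.filter_eq_self.2 fun p hp => decide_eq_true (hY p hp)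
    simp [List.filter_append, h1, h2, h3, h4]
  have f3 : (((X ++ (piece (m - L.numNodes) L ++ (piece (m + 1) R ++ Y))).find?
      (fun p => decide (p.1 + (p.2.numNodes : ℤ) = m))).map Prod.snd).getD .nil = L := by
    have h1 : X.find? (fun p => decide (p.1 + (p.2.numNodes : ℤ) = m)) = none :=
      List.find?_eq_none.2 fun p hp => by
        have := hX p hp
        simp only [decide_eq_true_eq]
        omega
    have h3 : (piece (m + 1) R).find? (fun p => decide (p.1 + (p.2.numNodes : ℤ) = m)) = none :=
      List.find?_eq_none.2 fun p hp => by
        obtain ⟨-, rfl⟩ := mem_piece.1 hp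
        simp only [decide_eq_true_eq]
        omega
    have h4 : Y.find? (fun p => decide (p.1 + (p.2.numNodes : ℤ) = m)) = none :=
      List.find?_eq_none.2 fun p hp => by
        have := hY p hp
        simp only [decide_eq_true_eq]
        omega
    cases L with
    | nil => rw [List.find?_append, h1, List.find?_append, List.find?_append, h3, h4]; rfl
    | node b l r => simp [List.find?_append, h1, piece]
  have f4 : (((X ++ (piece (m - L.numNodes) L ++ (piece (m + 1) R ++ Y))).find?
      (fun p => decide (p.1 = m + 1))).map Prod.snd).getD .nil = R := by
    have h1 : X.find? (fun p => decide (p.1 = m + 1)) = none :=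
      List.find?_eq_none.2 fun p hp => by
        have := hX p hp
        simp only [decide_eq_true_eq]
        omega
    have h2 : (piece (m - L.numNodes) L).find? (fun p => decide (p.1 = m + 1)) = none :=
      List.find?_eq_none.2 fun p hp => by
        obtain ⟨-, rfl⟩ := mem_piece.1 hp
        simp only [decide_eq_true_eq]
        omega
    have h4 : Y.find? (fun p => decide (p.1 = m + 1)) = none :=
      List.find?_eq_none.2 fun p hp => by
        have := hY p hp
        simp only [decide_eq_true_eq]
        omega
    cases R with
    | nil => rw [List.find?_append, h1, List.find?_append, h2, List.find?_append, h4]; rfl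
    | node b l r => rw [List.find?_append, h1, List.find?_append, h2]; simp [piece]
  simp only [insertLetter, hm, f1, f2, f3, f4]

theorem newPosition_eq {X Y : Forest Letter} {L R : BinaryTree Letter} {m : ℤ} {a : Letter}
    (hX : ∀ p ∈ X, p.1 + (p.2.numNodes : ℤ) < m) (hY : ∀ p ∈ Y, m + 1 < p.1)
    (hP : IsIndexedForest (X ++ (piece (m - L.numNodes) L ++ (piece (m + 1) R ++ Y))))
    (ha : NodeCondition a m L R) :
    newPosition a (X ++ (piece (m - L.numNodes) L ++ (piece (m + 1) R ++ Y))) = m := by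
  rcases ha with h | ⟨h1, h2, h3⟩ | ⟨h1, h2, h3⟩
  · have hf : (X ++ (piece (m - L.numNodes) L ++ (piece (m + 1) R ++ Y))).find?
        (fun p => decide (p.1 ≤ val a ∧ val a < p.1 + p.2.numNodes)) = none := by
      refine List.find?_eq_none.2 fun p hp => ?_
      simp only [List.mem_append, mem_piece] at hp
      simp only [decide_eq_true_eq]
      rcases hp with hp | ⟨-, rfl⟩ | ⟨-, rfl⟩ | hp
      · have := hX p hp
        omega
      · dsimp only
        omega
      · dsimp only
        omega
      · have := hY p hp
        omega
    simp only [newPosition, hf]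
    exact h
  · cases L with
    | nil => simp at h1; omega
    | node b l r =>
      have hf := hP.find?_eq (p := (m - (BinaryTree.node b l r).numNodes, .node b l r))
        (x := val a) (by simp) ⟨h1, by dsimp only; omega⟩
      have hb : b < a := h3
      simp only [newPosition, hf, hb, if_true]
      omega
  · cases R with
    | nil => simp at h2; omega
    | node b l r =>
      have hf := hP.find?_eq (p := (m + 1, .node b l r))
        (x := val a) (by simp) ⟨by dsimp only; omega, by dsimp only; omega⟩
      have hb : ¬ b < a := not_lt_of_gt h3
      simp only [newPosition, hf, hb, if_false]
      omega

theorem exists_split_right {P : Forest Letter} {m : ℤ} (hP : IsIndexedForest P)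
    (hm : ∀ p ∈ P, m < p.1) :
    ∃ (R : BinaryTree Letter) (Y : Forest Letter), P = piece (m + 1) R ++ Y ∧
      ∀ p ∈ Y, m + 1 < p.1 := by
  obtain ⟨hP, hPP⟩ := hP
  cases P with
  | nil => exact ⟨.nil, [], rfl, by simp⟩
  | cons x P =>
    obtain ⟨s, T⟩ := x
    rw [List.pairwise_cons] at hPP
    have h0 := hm (s, T) (by simp)
    dsimp only at h0
    by_cases h1 : s = m + 1
    · subst h1
      refine ⟨T, P, ?_, fun p hp => ?_⟩
      · cases T with
        | nil => exact absurd rfl (hP _ (List.mem_cons_self ..))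
        | node b l r => rfl
      · have := hPP.1 p hp
        dsimp only at this
        omega
    · refine ⟨.nil, (s, T) :: P, rfl, fun p hp => ?_⟩
      rcases List.mem_cons.1 hp with rfl | hp
      · dsimp only
        omega
      · have := hPP.1 p hp
        dsimp only at this
        omega

/-- An indexed forest is split at any `m` outside its support. -/
theorem exists_split {P : Forest Letter} {m : ℤ} (hP : IsIndexedForest P)
    (hm : ∀ p ∈ P, p.1 + (p.2.numNodes : ℤ) ≤ m ∨ m < p.1) :
    ∃ (X Y : Forest Letter) (L R : BinaryTree Letter),
      P = X ++ (piece (m - L.numNodes) L ++ (piece (m + 1) R ++ Y)) ∧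
      (∀ p ∈ X, p.1 + (p.2.numNodes : ℤ) < m) ∧ ∀ p ∈ Y, m + 1 < p.1 := by
  induction P with
  | nil => exact ⟨[], [], .nil, .nil, rfl, by simp, by simp⟩
  | cons x P ih =>
    obtain ⟨s, T⟩ := x
    have hP' : IsIndexedForest P :=
      ⟨fun p hp => hP.1 p (List.mem_cons_of_mem _ hp), (List.pairwise_cons.1 hP.2).2⟩
    have hx : ∀ p ∈ P, s + (T.numNodes : ℤ) < p.1 := (List.pairwise_cons.1 hP.2).1
    rcases hm (s, T) (by simp) with h | h <;> dsimp only at h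
    · rcases h.lt_or_eq with h | h
      · obtain ⟨X, Y, L, R, rfl, hX, hY⟩ := ih hP' fun p hp => hm p (List.mem_cons_of_mem _ hp)
        refine ⟨(s, T) :: X, Y, L, R, rfl, ?_, hY⟩
        rintro p hp
        rcases List.mem_cons.1 hp with rfl | hp
        · exact h
        · exact hX p hp
      · obtain ⟨R, Y, rfl, hY⟩ := exists_split_right hP' fun p hp => h ▸ hx p hp
        refine ⟨[], Y, T, R, ?_, by simp, hY⟩
        have hs : m - T.numNodes = s := by omega
        rw [hs]
        cases T with
        | nil => exact absurd rfl (hP.1 _ (List.mem_cons_self ..))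
        | node b l r => rfl
    · obtain ⟨R, Y, h', hY⟩ := exists_split_right (m := m) hP fun p hp => by
        rcases List.mem_cons.1 hp with rfl | hp
        · exact h
        · have := hx p hp
          omega
      exact ⟨[], Y, .nil, R, by simpa [piece] using h', by simp, hY⟩

/-- Every letter not yet used is inserted at some place satisfying the node condition. -/
theorem exists_nodeCondition {P : Forest Letter} (hP : IsIndexedForest P) {a : Letter}
    (ha : a ∉ reading P) :
    ∃ (m : ℤ) (X Y : Forest Letter) (L R : BinaryTree Letter),
      P = X ++ (piece (m - L.numNodes) L ++ (piece (m + 1) R ++ Y)) ∧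
      (∀ p ∈ X, p.1 + (p.2.numNodes : ℤ) < m) ∧ (∀ p ∈ Y, m + 1 < p.1) ∧
      NodeCondition a m L R := by
  by_cases hf : ∃ p ∈ P, p.1 ≤ val a ∧ val a < p.1 + p.2.numNodes
  · obtain ⟨⟨s, T⟩, hp, h1, h2⟩ := hf
    dsimp only at h1 h2
    cases T with
    | nil => exact absurd rfl (hP.1 _ hp)
    | node b l r =>
      have hab : a ≠ b := by
        rintro rfl
        exact ha (List.mem_flatMap.2 ⟨_, hp, by simp [postorder]⟩)
      rcases lt_or_gt_of_ne hab with hab | hab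
      · obtain ⟨X, Y, L, R, rfl, hX, hY⟩ := exists_split (m := s - 1) hP fun q hq => by
          rcases hP.trichotomy hp hq with rfl | h | h
          · dsimp only; omega
          · dsimp only at h; omega
          · dsimp only at h; omega
        refine ⟨s - 1, X, Y, L, R, rfl, hX, hY, Or.inr (Or.inr ?_)⟩
        simp only [List.mem_append, mem_piece, Prod.mk.injEq] at hp
        rcases hp with hp | ⟨-, hp, -⟩ | ⟨-, -, rfl⟩ | hp
        · have := hX _ hp
          dsimp only at this
          omega
        · omega
        · exact ⟨by omega, by omega, hab⟩
        · have := hY _ hp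
          dsimp only at this
          omega
      · obtain ⟨X, Y, L, R, rfl, hX, hY⟩ :=
          exists_split (m := s + (BinaryTree.node b l r).numNodes) hP fun q hq => by
            rcases hP.trichotomy hp hq with rfl | h | h
            · dsimp only; omega
            · dsimp only at h; omega
            · dsimp only at h; omega
        refine ⟨_, X, Y, L, R, rfl, hX, hY, Or.inr (Or.inl ?_)⟩
        simp only [List.mem_append, mem_piece, Prod.mk.injEq] at hp
        rcases hp with hp | ⟨-, -, rfl⟩ | ⟨-, hp, -⟩ | hp
        · have := hX _ hp
          dsimp only at this
          omega
        · exact ⟨by omega, by omega, hab⟩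
        · omega
        · have := hY _ hp
          dsimp only at this
          omega
  · push Not at hf
    obtain ⟨X, Y, L, R, rfl, hX, hY⟩ := exists_split (m := val a) hP fun p hp => by
      have := hf p hp
      omega
    exact ⟨val a, X, Y, L, R, rfl, hX, hY, Or.inl rfl⟩

/-- Joining two trees under a new root, or removing a root, preserves validity. -/
theorem isSymbol_join_iff {X Y : Forest Letter} {L R : BinaryTree Letter} {m : ℤ} {a : Letter} :
    IsSymbol (X ++ (m - (L.numNodes : ℤ), .node a L R) :: Y) ↔
      IsSymbol (X ++ (piece (m - L.numNodes) L ++ (piece (m + 1) R ++ Y))) ∧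
      (∀ p ∈ X, p.1 + (p.2.numNodes : ℤ) < m) ∧ (∀ p ∈ Y, m + 1 < p.1) ∧
      (∀ p ∈ X, ∀ q ∈ Y, p.1 + (p.2.numNodes : ℤ) < q.1) ∧ NodeCondition a m L R := by
  have e1 : m - (L.numNodes : ℤ) + L.numNodes = m := by omega
  constructor
  · rintro ⟨⟨h1, h2⟩, h3⟩
    have hv := h3 (m - (L.numNodes : ℤ), .node a L R) (by simp)
    simp only [IsValid, e1] at hv
    simp only [List.pairwise_append, List.pairwise_cons, List.mem_cons, forall_eq_or_imp,
      BinaryTree.numNodes] at h2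
    push_cast at h2
    obtain ⟨h2, ⟨h4, h5⟩, h6⟩ := h2
    refine ⟨⟨⟨?_, ?_⟩, ?_⟩, fun p hp => ?_, fun p hp => ?_, fun p hp => (h6 p hp).2, hv.2.2⟩
    · intro p hp
      simp only [List.mem_append, mem_piece] at hp
      rcases hp with hp | ⟨hp, rfl⟩ | ⟨hp, rfl⟩ | hp
      · exact h1 p (by simp [hp])
      · exact hp
      · exact hp
      · exact h1 p (by simp [hp])
    · simp only [List.pairwise_append, pairwise_piece, h2, h5, List.mem_append, mem_piece]
      refine ⟨trivial, ⟨trivial, ⟨trivial, trivial, ?_⟩, ?_⟩, ?_⟩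
      · rintro p ⟨-, rfl⟩ q hq
        have := h4 q hq
        dsimp only
        omega
      · rintro p ⟨-, rfl⟩ q (⟨-, rfl⟩ | hq)
        · dsimp only
          omega
        · have := h4 q hq
          dsimp only
          omega
      · rintro p hp q (⟨-, rfl⟩ | ⟨-, rfl⟩ | hq)
        · have := (h6 p hp).1
          dsimp only
          omega
        · have := (h6 p hp).1
          dsimp only
          omega
        · exact (h6 p hp).2 q hq
    · intro p hp
      simp only [List.mem_append, mem_piece] at hp
      rcases hp with hp | ⟨-, rfl⟩ | ⟨-, rfl⟩ | hp
      · exact h3 p (by simp [hp])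
      · exact hv.1
      · exact hv.2.1
      · exact h3 p (by simp [hp])
    · have := (h6 p hp).1
      omega
    · have := h4 p hp
      omega
  · rintro ⟨⟨⟨h1, h2⟩, h3⟩, hX, hY, hXY, ha⟩
    have hL : ∀ p ∈ X, p.1 + (p.2.numNodes : ℤ) < m - L.numNodes := by
      intro p hp
      by_cases hL : L = .nil
      · subst hL
        simpa using hX p hp
      · have := (List.pairwise_append.1 h2).2.2 p hp (m - L.numNodes, L) (by simp [hL])
        simpa using this
    have hR : ∀ p ∈ Y, m + 1 + R.numNodes < p.1 := by
      intro p hp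
      by_cases hR : R = .nil
      · subst hR
        simpa using hY p hp
      · have := (List.pairwise_append.1 (List.pairwise_append.1
          (List.pairwise_append.1 h2).2.1).2.1).2.2 (m + 1, R) (by simp [hR]) p hp
        simpa using this
    refine ⟨⟨?_, ?_⟩, ?_⟩
    · intro p hp
      simp only [List.mem_append, List.mem_cons] at hp
      rcases hp with hp | rfl | hp
      · exact h1 p (by simp [hp])
      · simp
      · exact h1 p (by simp [hp])
    · simp only [List.pairwise_append, List.pairwise_cons, List.mem_cons, forall_eq_or_imp,
        BinaryTree.numNodes] at h2 ⊢
      push_cast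
      refine ⟨h2.1, ⟨fun p hp => ?_, h2.2.1.2.1.2.1⟩, fun p hp => ⟨hL p hp, hXY p hp⟩⟩
      have := hR p hp
      omega
    · intro p hp
      simp only [List.mem_append, List.mem_cons] at hp
      rcases hp with hp | rfl | hp
      · exact h3 p (by simp [hp])
      · simp only [IsValid, e1]
        refine ⟨?_, ?_, ha⟩
        · by_cases hL : L = .nil
          · subst hL
            trivial
          · exact h3 (m - L.numNodes, L) (by simp [hL])
        · by_cases hR : R = .nil
          · subst hR
            trivial
          · exact h3 (m + 1, R) (by simp [hR])
      · exact h3 p (by simp [hp])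

/-- Inserting a new letter in a `P`-symbol. -/
theorem exists_insertLetter {P : Forest Letter} (hP : IsSymbol P) {a : Letter}
    (ha : a ∉ reading P) :
    ∃ (m : ℤ) (X Y : Forest Letter) (L R : BinaryTree Letter),
      P = X ++ (piece (m - L.numNodes) L ++ (piece (m + 1) R ++ Y)) ∧
      insertLetter P a = X ++ (m - (L.numNodes : ℤ), .node a L R) :: Y ∧
      IsSymbol (X ++ (m - (L.numNodes : ℤ), .node a L R) :: Y) := by
  obtain ⟨m, X, Y, L, R, rfl, hX, hY, h⟩ := exists_nodeCondition hP.1 ha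
  refine ⟨m, X, Y, L, R, rfl, insertLetter_eq hX hY (newPosition_eq hX hY hP.1 h),
    isSymbol_join_iff.2 ⟨hP, hX, hY, fun p hp q hq => ?_, h⟩⟩
  have := hX p hp
  have := hY q hq
  omega

/-- Removing a root from a `P`-symbol and inserting its label again. -/
theorem insertLetter_of_isSymbol {X Y : Forest Letter} {L R : BinaryTree Letter} {m : ℤ}
    {a : Letter} (h : IsSymbol (X ++ (m - (L.numNodes : ℤ), .node a L R) :: Y)) :
    insertLetter (X ++ (piece (m - L.numNodes) L ++ (piece (m + 1) R ++ Y))) a =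
      X ++ (m - (L.numNodes : ℤ), .node a L R) :: Y := by
  obtain ⟨hP, hX, hY, -, h⟩ := isSymbol_join_iff.1 h
  exact insertLetter_eq hX hY (newPosition_eq hX hY hP.1 h)

/-! ### The words with a given `P`-symbol -/

theorem wordProd_append (i j : List ℤ) : wordProd (i ++ j) = wordProd i * wordProd j := by
  simp [wordProd]

theorem wordProd_singleton (x : ℤ) : wordProd [x] = Equiv.swap x (x + 1) := by
  simp [wordProd]

theorem commute_wordProd {x : ℤ} {i : List ℤ} (h : ∀ y ∈ i, x + 2 ≤ y) :
    Commute (Equiv.swap x (x + 1)) (wordProd i) := by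
  refine Commute.list_prod_right _ _ fun g hg => ?_
  obtain ⟨y, hy, rfl⟩ := List.mem_map.1 hg
  have := h y hy
  refine (Equiv.Perm.disjoint_swap_swap ?_).commute
  simp
  omega

theorem lt_val_of_mem_reading {P : Forest Letter} {m : ℤ} (hP : ∀ p ∈ P, IsValid p.1 p.2)
    (hm : ∀ p ∈ P, m < p.1) : ∀ b ∈ reading P, m < val b := by
  intro b hb
  obtain ⟨p, hp, hb⟩ := List.mem_flatMap.1 hb
  exact (hm p hp).trans_le ((hP p hp).val_mem b hb).1

/-- The letters of the trees right of a node exceed the value of its label by at least two. -/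
theorem IsSymbol.val_right {X Y : Forest Letter} {T : BinaryTree Letter} {s : ℤ}
    (h : IsSymbol (X ++ (s, T) :: Y)) {a : Letter} (ha : a ∈ postorder T) :
    ∀ b ∈ reading Y, val a + 2 ≤ val b := by
  obtain ⟨⟨-, h1⟩, h2⟩ := h
  intro b hb
  have h3 := (h2 (s, T) (by simp)).val_mem a ha
  have h4 := lt_val_of_mem_reading (m := s + T.numNodes) (fun p hp => h2 p (by simp [hp]))
    (List.pairwise_cons.1 (List.pairwise_append.1 h1).2.1).1 b hb
  dsimp only at h3
  omega

/-- What a word shares with the postorder reading of its `P`-symbol. The last two properties hold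
because an inserted letter only ever moves past letters of the reading that exceed it by at least
two. -/
theorem foldl_insertLetter (W : List Letter) (hW : W.Nodup) :
    IsSymbol (W.foldl insertLetter []) ∧
    W.Perm (reading (W.foldl insertLetter [])) ∧
    (∀ r : Letter → Letter → Prop, W.Pairwise r → ForestRel r (W.foldl insertLetter [])) ∧
    wordProd (W.map val) = wordProd ((reading (W.foldl insertLetter [])).map val) ∧
    ∀ v : ℤ, W.filter (fun b => decide (val b = v)) =
      (reading (W.foldl insertLetter [])).filter (fun b => decide (val b = v)) := by
  induction W using List.reverseRecOn with
  | nil => simp [IsSymbol, IsIndexedForest, ForestRel, reading]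
  | append_singleton W a ih =>
    obtain ⟨hW, -, ha⟩ := List.nodup_append.1 hW
    obtain ⟨h1, h2, h3, h4, h5⟩ := ih hW
    have ha' : a ∉ W := fun h => ha a h a (by simp) rfl
    rw [List.foldl_append, List.foldl_cons, List.foldl_nil]
    generalize W.foldl insertLetter [] = P at *
    obtain ⟨m, X, Y, L, R, rfl, hins, hS⟩ := exists_insertLetter h1 (fun h => ha' (h2.mem_iff.2 h))
    rw [hins]
    have hY : ∀ b ∈ reading Y, val a + 2 ≤ val b := hS.val_right (by simp [postorder])
    simp only [reading_append, reading_piece, reading_cons, postorder] at h2 h4 h5 ⊢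
    refine ⟨hS, ?_, fun r hr => ?_, ?_, fun v => ?_⟩
    · refine (h2.append_right [a]).trans ?_
      simp only [List.append_assoc]
      exact (((List.perm_append_comm.append_left _).append_left _).append_left _)
    · obtain ⟨hr, -, hra⟩ := List.pairwise_append.1 hr
      replace h3 := h3 r hr
      have hroot : ∀ T : BinaryTree Letter, (∀ b ∈ postorder T, b ∈ W) →
          RootAll (r · a) T := by
        intro T hT
        cases T with
        | nil => trivial
        | node b l r => exact hra b (hT b (by simp [postorder])) a (by simp)
      have hsub : ∀ (s : ℤ) (T : BinaryTree Letter), (∀ p ∈ piece s T, TreeRel r p.2) →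
          TreeRel r T := by
        intro s T hT
        cases T with
        | nil => trivial
        | node b l r => exact hT _ (List.mem_singleton_self _)
      intro p hp
      simp only [List.mem_append, List.mem_cons] at hp
      rcases hp with hp | rfl | hp
      · exact h3 p (by simp [hp])
      · refine ⟨hroot L fun b hb => h2.mem_iff.2 (by simp [hb]),
          hroot R fun b hb => h2.mem_iff.2 (by simp [hb]),
          hsub (m - L.numNodes) L fun p hp => h3 p (by simp only [List.mem_append]; tauto),
          hsub (m + 1) R fun p hp => h3 p (by simp only [List.mem_append]; tauto)⟩
      · exact h3 p (by simp [hp])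
    · have hc := commute_wordProd (x := val a) (i := (reading Y).map val) fun y hy => by
        obtain ⟨b, hb, rfl⟩ := List.mem_map.1 hy
        exact hY b hb
      simp only [List.map_append, wordProd_append, List.map_cons, List.map_nil,
        wordProd_singleton] at h4 ⊢
      rw [h4]
      simp only [mul_assoc, hc.eq]
    -- A letter with the value of `a` cannot occur in `Y`, so `a` is the last such letter.
    · rw [List.filter_append, h5]
      simp only [List.filter_append, List.append_assoc]
      congr 3
      by_cases hv : val a = v
      · have : (reading Y).filter (fun b => decide (val b = v)) = [] :=
          List.filter_eq_nil_iff.2 fun b hb => by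
            have := hY b hb
            simp only [decide_eq_true_eq]
            omega
        simp [this]
      · simp [hv]

/-- In a tree whose edges go up along a transitive relation, so do all paths to the root. -/
theorem TreeRel.eq_or_rel_root {r : Letter → Letter → Prop} [IsTrans Letter r]
    {T : BinaryTree Letter} (hT : TreeRel r T) {a : Letter} (ha : a ∈ postorder T) :
    RootAll (fun b => a = b ∨ r a b) T := by
  induction T with
  | nil => trivial
  | node b L R ihL ihR =>
    obtain ⟨h1, h2, h3, h4⟩ := hT
    simp only [postorder, List.mem_append, List.mem_singleton] at ha
    have key : ∀ T : BinaryTree Letter, a ∈ postorder T → RootAll (r · b) T →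
        RootAll (fun b => a = b ∨ r a b) T → r a b := by
      intro T ha h h'
      cases T with
      | nil => simp [postorder] at ha
      | node c _ _ =>
        rcases h' with rfl | h'
        · exact h
        · exact _root_.trans h' h
    rcases ha with (ha | ha) | rfl
    · exact Or.inr (key L ha h1 (ihL h3 ha))
    · exact Or.inr (key R ha h2 (ihR h4 ha))
    · exact Or.inl rfl

/-- A word consisting of the labels of a `P`-symbol, in which children come before their parents,
has this `P`-symbol: its last letter is the label of a root, which can be removed. -/
theorem foldl_insertLetter_eq {r : Letter → Letter → Prop} [IsStrictOrder Letter r]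
    (W : List Letter) {P : Forest Letter} (hP : IsSymbol P) (hr : ForestRel r P)
    (hp : W.Perm (reading P)) (hW : W.Pairwise r) : W.foldl insertLetter [] = P := by
  induction W using List.reverseRecOn generalizing P with
  | nil =>
    cases P with
    | nil => rfl
    | cons p P =>
      obtain ⟨s, T⟩ := p
      cases T with
      | nil => exact absurd rfl (hP.1.1 _ (List.mem_cons_self ..))
      | node b l r => simpa [postorder] using hp.symm.eq_nil
  | append_singleton W a ih =>
    obtain ⟨hW, -, hWa⟩ := List.pairwise_append.1 hW
    rw [List.foldl_append, List.foldl_cons, List.foldl_nil]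
    obtain ⟨⟨s, T⟩, hT, ha⟩ := List.mem_flatMap.1 (hp.mem_iff.1 (by simp : a ∈ W ++ [a]))
    have hroot := (hr _ hT).eq_or_rel_root ha
    obtain ⟨X, Y, rfl⟩ := List.append_of_mem hT
    cases T with
    | nil => simp [postorder] at ha
    | node b L R =>
      -- The last letter of the word labels a root: a parent would have to come after it.
      have hab : a = b := by
        rcases hroot with h | h
        · exact h
        · have hb : b ∈ W ++ [a] := hp.mem_iff.2 (by simp [postorder])
          simp only [List.mem_append, List.mem_singleton] at hb
          rcases hb with hb | rfl
          · exact absurd (_root_.trans h (hWa b hb a (by simp))) (irrefl a)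
          · rfl
      subst hab
      obtain ⟨m, rfl⟩ : ∃ m, s = m - (L.numNodes : ℤ) := ⟨s + L.numNodes, by omega⟩
      rw [ih (isSymbol_join_iff.1 hP).1 ?_ ?_ hW, insertLetter_of_isSymbol hP]
      · intro p hp
        have hn := hr _ hT
        simp only [List.mem_append, mem_piece] at hp
        rcases hp with hp | ⟨-, rfl⟩ | ⟨-, rfl⟩ | hp
        · exact hr p (by simp [hp])
        · exact hn.2.2.1
        · exact hn.2.2.2
        · exact hr p (by simp [hp])
      · refine (List.perm_append_right_iff [a]).1 (hp.trans ?_)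
        simp only [reading_append, reading_piece, reading_cons, postorder, List.append_assoc]
        exact (((List.perm_append_comm.append_left _).append_left _).append_left _)

/-! ### Relabeled words -/

theorem map_val_relabelAux (i pre : List ℤ) : (relabelAux pre i).map val = i := by
  induction i generalizing pre with
  | nil => rfl
  | cons x i ih => simp [relabelAux, ih, val]

/-- A word is relabeled if, for each value, the indices of the letters with this value increase
from left to right in steps of one, starting at one. -/
theorem relabelAux_iff (W : List Letter) (pre : List ℤ) :
    W = relabelAux pre (W.map val) ↔
      ∀ v : ℤ, ((W.filter fun b => decide (val b = v)).map fun b => ((ofLex b).2 : ℕ)) =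
        List.range' (pre.count v + 1) (W.filter fun b => decide (val b = v)).length := by
  induction W generalizing pre with
  | nil => simp [relabelAux]
  | cons b W ih =>
    have hb : b = toLex (val b, (pre.count (val b)).succPNat) ↔
        ((ofLex b).2 : ℕ) = pre.count (val b) + 1 := by
      constructor
      · intro h
        rw [h]
        simp [val]
      · intro h
        have : (ofLex b).2 = (pre.count (val b)).succPNat := PNat.eq h
        rw [← this]
        rfl
    simp only [List.map_cons, relabelAux, List.cons.injEq, hb, ih (val b :: pre)]
    constructor
    · rintro ⟨h1, h2⟩ v
      have h2 := h2 v
      by_cases hv : val b = v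
      · subst hv
        rw [List.count_cons_self] at h2
        simp only [List.filter_cons, decide_true, if_true, List.map_cons, List.length_cons,
          List.range'_succ, h1, h2]
      · simpa [hv, List.count_cons] using h2
    · intro h
      refine ⟨?_, fun v => ?_⟩
      · have := h (val b)
        simp [List.range'_succ] at this
        exact this.1
      · have h2 := h v
        by_cases hv : val b = v
        · subst hv
          simp only [List.filter_cons, decide_true, if_true, List.map_cons, List.length_cons,
            List.range'_succ, List.cons.injEq] at h2
          rw [List.count_cons_self]
          exact h2.2
        · simpa [hv, List.count_cons] using h2

/-- In a relabeled word, equal values carry indices that increase from left to right. -/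
theorem pairwise_relabelAux (i pre : List ℤ) :
    (relabelAux pre i).Pairwise fun a b => val a = val b → a < b := by
  induction i generalizing pre with
  | nil => simp [relabelAux]
  | cons x i ih =>
    refine List.pairwise_cons.2 ⟨fun b hb h => ?_, ih _⟩
    have := lt_of_mem_relabelAux i (x :: pre) b hb
    rw [← h] at this
    refine Prod.Lex.lt_iff.2 (Or.inr ⟨h, ?_⟩)
    rw [← PNat.coe_lt_coe]
    simpa [val] using this

theorem relabel_injective : Function.Injective relabel := by
  intro i j h
  have := congrArg (fun W : InjWord => W.1.map val) h
  simpa [relabel, map_val_relabelAux] using this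

/-- The words of `Red(w)` are closed under the equivalence. -/
theorem mem_redInj_of_pSymbol_eq {w : Equiv.Perm ℤ} {W W' : InjWord} (hW : W ∈ RedInj w)
    (h : pSymbol W' = pSymbol W) : W' ∈ RedInj w := by
  obtain ⟨i, ⟨hi, hmin⟩, rfl⟩ := hW
  obtain ⟨-, h2, -, h4, h5⟩ := foldl_insertLetter _ W'.2
  obtain ⟨-, k2, -, k4, k5⟩ := foldl_insertLetter _ (relabel i).2
  change W'.1.foldl _ _ = (relabel i).1.foldl _ _ at h
  rw [h] at h2 h4 h5
  have e : (relabel i).1.map val = i := map_val_relabelAux i []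
  have hlen : (W'.1.map val).length = i.length := by
    conv_rhs => rw [← e]
    simpa using (h2.trans k2.symm).length_eq
  -- For each value, `W'` shows the same letters as `relabel i` in the same order.
  have hrel : W'.1 = relabelAux [] (W'.1.map val) := by
    rw [relabelAux_iff]
    intro v
    rw [h5 v, ← k5 v]
    refine (relabelAux_iff (relabel i).1 []).1 ?_ v
    rw [e]
    rfl
  refine ⟨W'.1.map val, ⟨?_, fun j hj => hlen.le.trans (hmin j hj)⟩, Subtype.ext hrel.symm⟩
  rw [h4, ← k4, e, hi]

/-! ### Nodes and labels -/

theorem label_mem_postorder : ∀ (T : BinaryTree Letter) (v : Nodes T), label T v ∈ postorder T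
  | .node _ _ _, none => by simp [label, postorder]
  | .node _ l _, some (.inl v) => by simp [label, postorder, label_mem_postorder l v]
  | .node _ _ r, some (.inr v) => by simp [label, postorder, label_mem_postorder r v]

theorem exists_label_eq {T : BinaryTree Letter} {b : Letter} (hb : b ∈ postorder T) :
    ∃ v, label T v = b := by
  induction T with
  | nil => simp [postorder] at hb
  | node a l r ihl ihr =>
    simp only [postorder, List.mem_append, List.mem_singleton] at hb
    rcases hb with (hb | hb) | rfl
    · obtain ⟨v, rfl⟩ := ihl hb
      exact ⟨some (.inl v), rfl⟩
    · obtain ⟨v, rfl⟩ := ihr hb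
      exact ⟨some (.inr v), rfl⟩
    · exact ⟨none, rfl⟩

theorem label_injective {T : BinaryTree Letter} (h : (postorder T).Nodup) :
    Function.Injective (label T) := by
  induction T with
  | nil => exact fun v => v.elim
  | node a l r ihl ihr =>
    rw [postorder, List.nodup_append, List.nodup_append] at h
    obtain ⟨⟨hl, hr, hlr⟩, -, ha⟩ := h
    have hal : ∀ v, label l v ≠ a := fun v =>
      ha _ (List.mem_append_left _ (label_mem_postorder l v)) a (by simp)
    have har : ∀ v, label r v ≠ a := fun v =>
      ha _ (List.mem_append_right _ (label_mem_postorder r v)) a (by simp)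
    have hlr' : ∀ v w, label l v ≠ label r w := fun v w =>
      hlr _ (label_mem_postorder l v) _ (label_mem_postorder r w)
    rintro (_ | v | v) (_ | w | w) h
    · rfl
    · exact absurd h.symm (hal w)
    · exact absurd h.symm (har w)
    · exact absurd h (hal v)
    · rw [ihl hl h]
    · exact absurd h (hlr' v w)
    · exact absurd h (har v)
    · exact absurd h.symm (hlr' w v)
    · rw [ihr hr h]

/-- The label of a node of a forest. -/
def forestLabel (P : Forest Letter) (v : InternalNodes P) : Letter :=
  label (P.get v.1).2 v.2

theorem mem_reading_iff {P : Forest Letter} {b : Letter} :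
    b ∈ reading P ↔ ∃ v, forestLabel P v = b := by
  constructor
  · intro h
    obtain ⟨p, hp, hb⟩ := List.mem_flatMap.1 h
    obtain ⟨k, rfl⟩ := List.mem_iff_get.1 hp
    obtain ⟨v, hv⟩ := exists_label_eq hb
    exact ⟨⟨k, v⟩, hv⟩
  · rintro ⟨v, rfl⟩
    exact List.mem_flatMap.2 ⟨_, List.get_mem P v.1, label_mem_postorder _ _⟩

theorem forestLabel_injective {P : Forest Letter} (h : (reading P).Nodup) :
    Function.Injective (forestLabel P) := by
  obtain ⟨h1, h2⟩ := List.nodup_flatMap.1 h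
  rintro ⟨k, v⟩ ⟨k', v'⟩ hv
  obtain rfl : k = k' := by
    have hd : ∀ k k' : Fin P.length, k < k' → ∀ v v',
        forestLabel P ⟨k, v⟩ ≠ forestLabel P ⟨k', v'⟩ :=
      fun k k' hk v v' he => List.pairwise_iff_get.1 h2 k k' hk (label_mem_postorder _ v)
        ((show label _ v = label _ v' from he) ▸ label_mem_postorder _ v')
    rcases lt_trichotomy k k' with hk | hk | hk
    · exact absurd hv (hd _ _ hk _ _)
    · exact hk
    · exact absurd hv.symm (hd _ _ hk _ _)
  rw [label_injective (h1 _ (List.get_mem P k)) (show label _ v = label _ v' from hv)]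

/-! ### Flagged labelings and linear extensions -/

/-- The letters ordered by decreasing values of `f`, ties being broken by the order of letters. -/
def prec (f : Letter → ℤ) (a b : Letter) : Prop := f b < f a ∨ (f a = f b ∧ a < b)

instance (f : Letter → ℤ) : IsStrictOrder Letter (prec f) where
  irrefl a h := by
    rcases h with h | h
    · exact lt_irrefl _ h
    · exact lt_irrefl _ h.2
  trans a b c h h' := by
    rcases h with h | ⟨h, hab⟩ <;> rcases h' with h' | ⟨h', hbc⟩
    · exact Or.inl (h'.trans h)
    · exact Or.inl (h'.symm.trans_lt h)
    · exact Or.inl (h'.trans_eq h.symm)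
    · exact Or.inr ⟨h.trans h', hab.trans hbc⟩

theorem prec_trichotomy (f : Letter → ℤ) (a b : Letter) : prec f a b ∨ a = b ∨ prec f b a := by
  unfold prec
  rcases lt_trichotomy (f a) (f b) with h | h | h
  · exact Or.inr (Or.inr (Or.inl h))
  · rcases lt_trichotomy a b with h' | h' | h'
    · exact Or.inl (Or.inr ⟨h, h'⟩)
    · exact Or.inr (Or.inl h')
    · exact Or.inr (Or.inr (Or.inr ⟨h.symm, h'⟩))
  · exact Or.inl (Or.inl h)

theorem exists_sorted (f : Letter → ℤ) {l : List Letter} (hl : l.Nodup) :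
    ∃ W : List Letter, W.Perm l ∧ W.Pairwise (prec f) := by
  classical
  let r : Letter → Letter → Prop := fun a b => prec f a b ∨ a = b
  have : Std.Total r := ⟨fun a b => by
    rcases prec_trichotomy f a b with h | h | h
    · exact Or.inl (Or.inl h)
    · exact Or.inl (Or.inr h)
    · exact Or.inr (Or.inl h)⟩
  have : IsTrans Letter r := ⟨fun a b c h h' => by
    rcases h with h | rfl
    · rcases h' with h' | rfl
      · exact Or.inl (_root_.trans h h')
      · exact Or.inl h
    · exact h'⟩
  have hp := List.perm_insertionSort r l
  refine ⟨l.insertionSort r, hp, ?_⟩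
  exact ((List.pairwise_insertionSort r l).and (hp.nodup_iff.2 hl)).imp
    fun h => h.1.resolve_right h.2

theorem eq_of_perm_of_pairwise_prec {f : Letter → ℤ} {l l' : List Letter} (h : l.Perm l')
    (hl : l.Pairwise (prec f)) (hl' : l'.Pairwise (prec f)) : l = l' :=
  h.eq_of_pairwise (fun a _ _ _ hab hba => absurd (_root_.trans hab hba) (irrefl a)) hl hl'

/-- As a valid labeling increases from left to right along edges, the inequalities for a flagged
labeling of a tree say that children come before their parents in the order `prec f`. -/
theorem isFlagged_iff_treeRel {s : ℤ} {T : BinaryTree Letter} (hT : IsValid s T)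
    (f : Letter → ℤ) : IsFlagged T (fun v => f (label T v)) ↔ TreeRel (prec f) T := by
  induction T generalizing s with
  | nil => exact Iff.rfl
  | node a L R ihL ihR =>
    obtain ⟨h1, h2⟩ := hT.rootAll_lt
    refine and_congr ?_ (and_congr ?_ (and_congr (ihL hT.1) (ihR hT.2.1)))
    · cases L with
      | nil => exact ⟨fun _ => trivial, fun _ v => v.elim⟩
      | node b l r =>
        have hb : b < a := h1
        have e : (∀ v, IsRoot (.node b l r) v → f a ≤ f (label (.node b l r) v)) ↔ f a ≤ f b :=
          ⟨fun h => h none rfl, fun h v hv => by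
            obtain rfl : v = none := hv
            exact h⟩
        refine e.trans ?_
        change _ ↔ (f a < f b ∨ (f b = f a ∧ b < a))
        constructor
        · intro h
          rcases h.lt_or_eq with h | h
          · exact Or.inl h
          · exact Or.inr ⟨h.symm, hb⟩
        · rintro (h | h)
          · exact h.le
          · exact h.1.ge
    · cases R with
      | nil => exact ⟨fun _ => trivial, fun _ v => v.elim⟩
      | node b l r =>
        have hb : a < b := h2
        have e : (∀ v, IsRoot (.node b l r) v → f a < f (label (.node b l r) v)) ↔ f a < f b :=
          ⟨fun h => h none rfl, fun h v hv => by
            obtain rfl : v = none := hv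
            exact h⟩
        refine e.trans ?_
        change _ ↔ (f a < f b ∨ (f b = f a ∧ b < a))
        exact ⟨Or.inl, fun h => h.resolve_right fun h => lt_asymm hb h.2⟩

theorem isFlagged_iff_forestRel {P : Forest Letter} (hP : IsSymbol P) {f : Letter → ℤ}
    {κ : InternalNodes P → ℤ} (hκ : ∀ v, f (forestLabel P v) = κ v) :
    (∀ k : Fin P.length, IsFlagged (P.get k).2 fun v => κ ⟨k, v⟩) ↔ ForestRel (prec f) P := by
  have e : ∀ k : Fin P.length, (IsFlagged (P.get k).2 fun v => κ ⟨k, v⟩) ↔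
      TreeRel (prec f) (P.get k).2 := fun k => by
    rw [← isFlagged_iff_treeRel (hP.2 _ (List.get_mem P k))]
    simp only [← hκ]
    rfl
  simp only [e]
  constructor
  · intro h p hp
    obtain ⟨k, rfl⟩ := List.mem_iff_get.1 hp
    exact h k
  · exact fun h k => h _ (List.get_mem P k)

/-! ### The polynomial of a class is a sum of slide polynomials -/

open Classical in
/-- The slide polynomial of a word, as a sum over functions on a set indexing its letters. -/
theorem slide_eq_sum {N : Type} [Fintype N] [DecidableEq N] {lab : N → Letter}
    (hlab : Function.Injective lab)
    {W : List Letter} (hW : W.Nodup) (hval : W.Pairwise fun a b => val a = val b → a < b)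
    (hmem : ∀ b, b ∈ W ↔ ∃ v, lab v = b) :
    slide (W.map val) = ∑ κ ∈ (Fintype.piFinset fun v => Finset.Icc 1 (val (lab v))).filter
      (fun κ => W.Pairwise (prec (Function.extend lab κ 0))), ∏ v, MvPolynomial.X (κ v) := by
  have hlen : (W.map val).length = W.length := by simp
  have hex : ∀ j : Fin (W.map val).length, ∃ v, lab v = W[(j : ℕ)]'(hlen ▸ j.2) := fun j =>
    (hmem _).1 (List.getElem_mem _)
  choose g hg using hex
  have hbij : Function.Bijective g := by
    constructor
    · intro j k h
      have := hg j
      rw [h, hg k] at this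
      exact Fin.ext ((hW.getElem_inj_iff).1 this).symm
    · intro v
      obtain ⟨j, hj, h⟩ := List.mem_iff_getElem.1 ((hmem _).2 ⟨v, rfl⟩)
      refine ⟨⟨j, hlen.symm ▸ hj⟩, hlab ?_⟩
      rw [hg]
      exact h
  let e : Fin (W.map val).length ≃ N := Equiv.ofBijective g hbij
  have he : ∀ j, lab (e j) = W[(j : ℕ)]'(hlen ▸ j.2) := hg
  symm
  refine Finset.sum_equiv (Equiv.arrowCongr e.symm (Equiv.refl ℤ)) (fun κ => ?_) fun κ _ => ?_
  · have hf : ∀ j (hj : j < W.length), Function.extend lab κ 0 W[j] =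
        κ (e ⟨j, hlen.symm ▸ hj⟩) := fun j hj => by
      have := he ⟨j, hlen.symm ▸ hj⟩
      dsimp only at this
      rw [← this, hlab.extend_apply]
    simp only [compatible, Finset.mem_filter, Fintype.mem_piFinset]
    refine and_congr ?_ ?_
    · rw [← e.forall_congr_right (q := fun v => κ v ∈ Finset.Icc 1 (val (lab v)))]
      refine forall_congr' fun j => ?_
      rw [he]
      simp [Equiv.arrowCongr]
    · rw [← List.isChain_iff_pairwise, List.isChain_iff_getElem]
      simp only [hlen]
      refine forall_congr' fun j => forall_congr' fun hj => ?_
      simp only [List.get_eq_getElem, List.getElem_map, prec, hf, Equiv.arrowCongr,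
        Equiv.coe_fn_mk, Function.comp_apply, Equiv.refl_apply, Equiv.symm_symm]
      -- As equal values occur in increasing order, descents of letters are descents of values.
      have h1 : W[j] < W[j + 1] ↔ ¬ val W[j + 1] < val W[j] := by
        constructor
        · exact fun h h' => lt_asymm h (lt_of_val_lt h')
        · intro h
          rcases (not_lt.1 h).lt_or_eq with h | h
          · exact lt_of_val_lt h
          · exact List.pairwise_iff_getElem.1 hval j (j + 1) (by omega) hj (by omega) h
      rw [h1]
      by_cases h2 : val W[j + 1] < val W[j]
      · simp only [h2, not_true, and_false, or_false, true_implies]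
        exact ⟨fun h => ⟨h.le, h⟩, fun h => h.2⟩
      · simp only [h2, not_false_iff, and_true, false_implies]
        omega
  · exact (Equiv.prod_comp e fun v => (MvPolynomial.X (κ v) : MvPolynomial ℤ ℚ)).symm

theorem OmegaClass.mem_words_iff {C : OmegaClass} {W : InjWord} :
    W ∈ C.words ↔ pSymbol W = C.symbol := by
  induction C using Quotient.inductionOn with
  | h W₀ => exact Quotient.eq (r := omegaSetoid)

theorem OmegaClass.isSymbol (C : OmegaClass) : IsSymbol C.symbol := by
  induction C using Quotient.inductionOn with
  | h W => exact (foldl_insertLetter W.1 W.2).1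

theorem OmegaClass.nodup (C : OmegaClass) : (reading C.symbol).Nodup := by
  induction C using Quotient.inductionOn with
  | h W => exact (foldl_insertLetter W.1 W.2).2.1.nodup_iff.1 W.2

/-- The words of a class are the linear extensions of its symbol: for a given function `f` on the
letters, the word sorted by `prec f` lies in the class if `f` restricts to a flagged labeling, and
no word sorted by `prec f` does otherwise. -/
theorem OmegaClass.poly_eq (C : OmegaClass) (hfin : C.words.Finite)
    (hC : ∀ W ∈ C.words, W.1.Pairwise fun a b => val a = val b → a < b) :
    C.poly = ∑ᶠ W ∈ C.words, slide (W.1.map val) := by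
  classical
  have hS := C.isSymbol
  have hinj := forestLabel_injective C.nodup
  have hperm : ∀ W ∈ C.words, W.1.Perm (reading C.symbol) := fun W hW => by
    rw [← mem_words_iff.1 hW]
    exact (foldl_insertLetter W.1 W.2).2.1
  rw [finsum_mem_eq_finite_toFinset_sum _ hfin]
  have hslide : ∀ W ∈ hfin.toFinset, slide (W.1.map val) =
      ∑ κ ∈ Fintype.piFinset fun v => Finset.Icc 1 (val (forestLabel C.symbol v)),
        if W.1.Pairwise (prec (Function.extend (forestLabel C.symbol) κ 0)) then
          ∏ v, MvPolynomial.X (κ v) else 0 := fun W hW => by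
    have hW := hfin.mem_toFinset.1 hW
    rw [slide_eq_sum hinj W.2 (hC W hW) fun b => (hperm W hW).mem_iff.trans mem_reading_iff,
      Finset.sum_filter]
  rw [Finset.sum_congr rfl hslide, Finset.sum_comm]
  refine (Finset.sum_filter _ _).trans (Finset.sum_congr rfl fun κ _ => ?_)
  have hflag := isFlagged_iff_forestRel hS fun v => hinj.extend_apply κ 0 v
  generalize Function.extend (forestLabel C.symbol) κ 0 = f at *
  by_cases h : ForestRel (prec f) C.symbol
  · rw [if_pos (hflag.2 h)]
    obtain ⟨W, hW, hWf⟩ := exists_sorted f C.nodup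
    let W' : InjWord := ⟨W, hW.nodup_iff.2 C.nodup⟩
    have hW' : W' ∈ C.words := mem_words_iff.2 (foldl_insertLetter_eq W hS h hW hWf)
    rw [Finset.sum_eq_single W', if_pos hWf]
    · intro V hV hVW
      refine if_neg fun hVf => hVW (Subtype.ext ?_)
      exact eq_of_perm_of_pairwise_prec ((hperm V (hfin.mem_toFinset.1 hV)).trans hW.symm) hVf hWf
    · exact fun h => absurd (hfin.mem_toFinset.2 hW') h
  · rw [if_neg fun h' => h (hflag.1 h')]
    symm
    refine Finset.sum_eq_zero fun W hW => if_neg fun hWf => h ?_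
    rw [← mem_words_iff.1 (hfin.mem_toFinset.1 hW)]
    exact (foldl_insertLetter W.1 W.2).2.2.1 _ hWf

/-! ### Forest polynomials of the shapes of symbols -/

/-- The canonical label reached from a node by following left edges down is the least element of
the interval supporting the subtree of that node; here for the root of a tree. -/
theorem can_descendLeft_root {α : Type} (s : ℤ) (a : α) (L R : BinaryTree α) :
    can s (.node a L R) (descendLeft (.node a L R) none) = s := by
  induction L generalizing a R with
  | nil => exact add_zero s
  | node b l r ih _ => exact ih b r

theorem descendLeft_inl {α : Type} (a : α) (L R : BinaryTree α) (v : Nodes L) :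
    descendLeft (.node a L R) (some (.inl v)) = some (.inl (descendLeft L v)) := by
  cases L with
  | nil => exact v.elim
  | node b l r => rfl

theorem descendLeft_inr {α : Type} (a : α) (L R : BinaryTree α) (v : Nodes R) :
    descendLeft (.node a L R) (some (.inr v)) = some (.inr (descendLeft R v)) := by
  cases L with
  | nil => rfl
  | node b l r => rfl

theorem can_descendLeft_le {s : ℤ} {T : BinaryTree Letter} (hT : IsValid s T) (v : Nodes T) :
    can s T (descendLeft T v) ≤ val (label T v) := by
  induction T generalizing s with
  | nil => exact v.elim
  | node a L R ihL ihR =>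
    rcases v with _ | v | v
    · rw [can_descendLeft_root]
      exact hT.val_root.1
    · rw [descendLeft_inl]
      exact ihL hT.1 v
    · rw [descendLeft_inr]
      exact ihR hT.2.1 v

/-- A flagged labeling bounded by the values of the labels is bounded by the least elements of the
subtrees. This is inherited from the left child if there is one. If there is only a right child,
its subtree starts one further to the right, and the labeling increases strictly. At a leaf, the
value of the label is the canonical label. -/
theorem le_can_descendLeft {s : ℤ} {T : BinaryTree Letter} (hT : IsValid s T) {κ : Nodes T → ℤ}
    (hκ : IsFlagged T κ) (hle : ∀ v, κ v ≤ val (label T v)) (v : Nodes T) :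
    κ v ≤ can s T (descendLeft T v) := by
  induction T generalizing s with
  | nil => exact v.elim
  | node a L R ihL ihR =>
    obtain ⟨h1, h2, h3, h4⟩ := hκ
    have hL := ihL hT.1 h3 fun v => hle (some (.inl v))
    have hR := ihR hT.2.1 h4 fun v => hle (some (.inr v))
    rcases v with _ | v | v
    · rw [can_descendLeft_root]
      cases L with
      | node b l r =>
        refine (h1 none rfl).trans ((hL none).trans_eq ?_)
        exact can_descendLeft_root s b l r
      | nil =>
        cases R with
        | node b l r =>
          have h5 := hR none
          rw [can_descendLeft_root] at h5
          have h6 := h2 none rfl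
          simp only [BinaryTree.numNodes, Nat.cast_zero] at h5
          omega
        | nil =>
          have h5 := hT.val_root.2
          have h6 : κ none ≤ val a := hle none
          simp only [BinaryTree.numNodes] at h5
          omega
    · rw [descendLeft_inl]
      exact hL v
    · rw [descendLeft_inr]
      exact hR v

theorem numNodes_map (T : BinaryTree Letter) : (T.map fun _ => ()).numNodes = T.numNodes := by
  induction T with
  | nil => rfl
  | node a L R ihL ihR => simp [BinaryTree.map, ihL, ihR]

/-- The nodes of a tree correspond to those of its underlying unlabeled tree. -/
theorem exists_nodes_equiv (T : BinaryTree Letter) :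
    ∃ e : Nodes (T.map fun _ => ()) ≃ Nodes T,
      (∀ κ, IsFlagged (T.map fun _ => ()) (fun v => κ (e v)) ↔ IsFlagged T κ) ∧
      (∀ v, IsRoot (T.map fun _ => ()) v ↔ IsRoot T (e v)) ∧
      ∀ s v, can s (T.map fun _ => ()) (descendLeft (T.map fun _ => ()) v) =
        can s T (descendLeft T (e v)) := by
  induction T with
  | nil =>
    exact ⟨Equiv.refl Empty, fun κ => Iff.rfl, fun v => v.elim, fun s v => v.elim⟩
  | node a L R ihL ihR =>
    obtain ⟨e, h1, h2, h4⟩ := ihL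
    obtain ⟨f, k1, k2, k4⟩ := ihR
    refine ⟨Equiv.optionCongr (Equiv.sumCongr e f), fun κ => ?_, ?_, ?_⟩
    · refine and_congr ?_ (and_congr ?_
        (and_congr (h1 fun v => κ (some (.inl v))) (k1 fun v => κ (some (.inr v)))))
      · rw [← e.forall_congr_right]
        exact forall_congr' fun v => imp_congr (h2 v) Iff.rfl
      · rw [← f.forall_congr_right]
        exact forall_congr' fun v => imp_congr (k2 v) Iff.rfl
    · rintro (_ | v | v)
      · exact ⟨fun _ => rfl, fun _ => rfl⟩
      · exact ⟨fun h => (Option.some_ne_none _ h).elim, fun h => (Option.some_ne_none _ h).elim⟩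
      · exact ⟨fun h => (Option.some_ne_none _ h).elim, fun h => (Option.some_ne_none _ h).elim⟩
    · rintro s (_ | v | v)
      · exact (can_descendLeft_root s () _ _).trans (can_descendLeft_root s a L R).symm
      · have e1 := descendLeft_inl () (L.map fun _ => ()) (R.map fun _ => ()) v
        have e2 := descendLeft_inl a L R (e v)
        exact (congrArg (can s _) e1).trans ((h4 s v).trans (congrArg (can s _) e2).symm)
      · have e1 := descendLeft_inr () (L.map fun _ => ()) (R.map fun _ => ()) v
        have e2 := descendLeft_inr a L R (f v)
        refine (congrArg (can s _) e1).trans (Eq.trans ?_ (congrArg (can s _) e2).symm)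
        have := k4 (s + L.numNodes + 1) v
        rw [← numNodes_map L] at this
        refine this.trans ?_
        rw [numNodes_map]
        rfl

theorem isIndexedForest_shape {P : Forest Letter} (hP : IsIndexedForest P) :
    IsIndexedForest P.shape := by
  refine ⟨fun p hp => ?_, ?_⟩
  · obtain ⟨⟨s, T⟩, hq, rfl⟩ := List.mem_map.1 hp
    have := hP.1 _ hq
    cases T with
    | nil => exact absurd rfl this
    | node a L R => simp [BinaryTree.map]
  · refine List.pairwise_map.2 (hP.2.imp fun h => ?_)
    simpa [numNodes_map] using h

/-- The nodes of a labeled forest correspond to those of its shape. -/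
theorem exists_internalNodes_equiv (P : Forest Letter) :
    ∃ e : InternalNodes P.shape ≃ InternalNodes P,
      (∀ κ : InternalNodes P → ℤ,
        (∀ k, IsFlagged (P.shape.get k).2 fun v => κ (e ⟨k, v⟩)) ↔
          ∀ k, IsFlagged (P.get k).2 fun v => κ ⟨k, v⟩) ∧
      ∀ v, rho P.shape v = rho P (e v) := by
  have hlen : P.shape.length = P.length := List.length_map ..
  have hget : ∀ k : Fin P.shape.length, P.shape.get k =
      ((P.get (finCongr hlen k)).1, (P.get (finCongr hlen k)).2.map fun _ => ()) := fun k => by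
    exact List.getElem_map (fun p : ℤ × BinaryTree Letter => (p.1, p.2.map fun _ => ()))
  have hk : ∀ k : Fin P.shape.length,
      ∃ e : Nodes (P.shape.get k).2 ≃ Nodes (P.get (finCongr hlen k)).2,
      (∀ κ, IsFlagged (P.shape.get k).2 (fun v => κ (e v)) ↔
        IsFlagged (P.get (finCongr hlen k)).2 κ) ∧
      ∀ v, can (P.shape.get k).1 (P.shape.get k).2 (descendLeft (P.shape.get k).2 v) =
        can (P.get (finCongr hlen k)).1 (P.get (finCongr hlen k)).2
          (descendLeft (P.get (finCongr hlen k)).2 (e v)) := fun k => by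
    rw [hget k]
    obtain ⟨e, h1, -, h2⟩ := exists_nodes_equiv (P.get (finCongr hlen k)).2
    exact ⟨e, h1, h2 _⟩
  choose e he1 he2 using hk
  refine ⟨Equiv.sigmaCongr (finCongr hlen) e, fun κ => ?_, fun v => he2 v.1 v.2⟩
  rw [← (finCongr hlen).forall_congr_right]
  exact forall_congr' fun k => he1 k fun v => κ ⟨finCongr hlen k, v⟩

theorem forestPoly_shape (P : Forest Letter) : forestPoly P.shape = flaggedPoly P (rho P) := by
  obtain ⟨e, h1, h2⟩ := exists_internalNodes_equiv P
  symm
  refine Finset.sum_equiv (Equiv.arrowCongr e.symm (Equiv.refl ℤ)) (fun κ => ?_) fun κ _ => ?_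
  · simp only [Finset.mem_filter, Fintype.mem_piFinset]
    refine and_congr ?_ (h1 κ).symm
    rw [← e.forall_congr_right]
    refine forall_congr' fun v => ?_
    rw [h2]
    rfl
  · exact (Equiv.prod_comp e fun v => (MvPolynomial.X (κ v) : MvPolynomial ℤ ℚ)).symm

theorem flaggedPoly_val_eq {P : Forest Letter} (hP : IsSymbol P) :
    flaggedPoly P (fun v => val (forestLabel P v)) = flaggedPoly P (rho P) := by
  refine Finset.sum_congr (Finset.ext fun κ => ?_) fun _ _ => rfl
  have hv : ∀ k : Fin P.length, IsValid (P.get k).1 (P.get k).2 := fun k =>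
    hP.2 _ (List.get_mem P k)
  simp only [Finset.mem_filter, Fintype.mem_piFinset, Finset.mem_Icc]
  refine and_congr_left fun hκ => ⟨fun h v => ⟨(h v).1, ?_⟩, fun h v => ⟨(h v).1, ?_⟩⟩
  · exact le_can_descendLeft (hv v.1) (hκ v.1) (fun u => (h ⟨v.1, u⟩).2) v.2
  · exact (h v).2.trans (can_descendLeft_le (hv v.1) v.2)

theorem OmegaClass.poly_eq_forestPoly (C : OmegaClass) : C.poly = forestPoly C.symbol.shape :=
  (flaggedPoly_val_eq C.isSymbol).trans (forestPoly_shape _).symm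

/-- A forest polynomial vanishes unless the support of the forest is positive. -/
theorem forestPoly_eq_zero {F : Forest Unit} (hF : IsIndexedForest F)
    {p : ℤ × BinaryTree Unit} (hp : p ∈ F) (hp1 : p.1 < 1) : forestPoly F = 0 := by
  obtain ⟨k, rfl⟩ := List.mem_iff_get.1 hp
  have hk : ∃ v : Nodes (F.get k).2, rho F ⟨k, v⟩ = (F.get k).1 := by
    have h0 := hF.1 _ hp
    unfold rho
    dsimp only
    generalize F.get k = q at *
    obtain ⟨s, T⟩ := q
    cases T with
    | nil => exact absurd rfl h0
    | node a L R => exact ⟨none, can_descendLeft_root s a L R⟩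
  obtain ⟨v, hv⟩ := hk
  refine Finset.sum_eq_zero fun κ hκ => ?_
  simp only [Finset.mem_filter, Fintype.mem_piFinset] at hκ
  have := hκ.1 ⟨k, v⟩
  rw [Finset.mem_Icc, hv] at this
  omega

/-! ### Finiteness of the set of reduced words -/

theorem wordProd_cons (x : ℤ) (i : List ℤ) :
    wordProd (x :: i) = Equiv.swap x (x + 1) * wordProd i := by
  simp [wordProd]

/-- The letters of a word below `g` and above `g` act independently if `g` is not a letter. -/
theorem wordProd_filter {g : ℤ} {i : List ℤ} (hg : g ∉ i) (x : ℤ) :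
    (x ≤ g → wordProd i x ≤ g ∧ wordProd (i.filter (· < g)) x = wordProd i x ∧
      wordProd (i.filter (g < ·)) x = x) ∧
    (g < x → g < wordProd i x ∧ wordProd (i.filter (· < g)) x = x ∧
      wordProd (i.filter (g < ·)) x = wordProd i x) := by
  induction i with
  | nil => simp [wordProd]
  | cons y i ih =>
    have hy : g ≠ y := fun h => hg (by simp [h])
    have hi : g ∉ i := fun h => hg (by simp [h])
    obtain ⟨ih1, ih2⟩ := ih hi
    have hs : ∀ z, (y < g → (z ≤ g → Equiv.swap y (y + 1) z ≤ g) ∧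
        (g < z → Equiv.swap y (y + 1) z = z)) ∧
        (g < y → (z ≤ g → Equiv.swap y (y + 1) z = z) ∧
        (g < z → g < Equiv.swap y (y + 1) z)) := fun z => by
      rw [Equiv.swap_apply_def]
      split_ifs <;> omega
    rcases lt_or_gt_of_ne hy with h | h
    · have h' : ¬ y < g := by omega
      simp only [List.filter_cons, h, h', decide_true, decide_false, if_true, wordProd_cons,
        Equiv.Perm.mul_apply]
      constructor <;> intro hx
      · obtain ⟨a1, a2, a3⟩ := ih1 hx
        have := ((hs (wordProd i x)).2 h).1 a1
        simp_all
      · obtain ⟨a1, a2, a3⟩ := ih2 hx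
        have := ((hs (wordProd i x)).2 h).2 a1
        simp_all
    · have h' : ¬ g < y := by omega
      simp only [List.filter_cons, h, h', decide_true, decide_false, if_true, wordProd_cons,
        Equiv.Perm.mul_apply]
      constructor <;> intro hx
      · obtain ⟨a1, a2, a3⟩ := ih1 hx
        have := ((hs (wordProd i x)).1 h).1 a1
        simp_all
      · obtain ⟨a1, a2, a3⟩ := ih2 hx
        have := ((hs (wordProd i x)).1 h).2 a1
        simp_all

/-- Among more consecutive integers than a word has letters, one is not a letter. -/
theorem exists_not_mem_word (i : List ℤ) (a : ℤ) : ∃ g ∉ i, a ≤ g ∧ g ≤ a + i.length := by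
  by_contra! h
  have h1 : Finset.Icc a (a + i.length) ⊆ i.toFinset := fun g hg => by
    rw [Finset.mem_Icc] at hg
    by_contra hgi
    exact absurd hg.2 (not_le.2 (h g (fun hm => hgi (List.mem_toFinset.2 hm)) hg.1))
  have h2 := (Finset.card_le_card h1).trans (List.toFinset_card_le i)
  rw [Int.card_Icc] at h2
  omega

/-- A reduced word of length `k` of a permutation moving only elements of `[a, b]` has letters in
`[a - k - 1, b + k]`: otherwise there is an integer outside `[a, b - 1]` which is not a letter and
beyond which there are letters, and these can be dropped. -/
theorem mem_Icc_of_mem_red {w : Equiv.Perm ℤ} {a b : ℤ} (hw : ∀ x, w x ≠ x → a ≤ x ∧ x ≤ b)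
    {i : List ℤ} (hi : i ∈ Red w) {x : ℤ} (hx : x ∈ i) :
    a - i.length - 1 ≤ x ∧ x ≤ b + i.length := by
  obtain ⟨hiw, hmin⟩ := hi
  constructor
  · by_contra! h
    obtain ⟨g, hg, h1, h2⟩ := exists_not_mem_word i (a - i.length - 1)
    have hw' : wordProd (i.filter (g < ·)) = w := by
      ext z
      rcases le_or_gt z g with hz | hz
      · rw [((wordProd_filter hg z).1 hz).2.2]
        by_contra hne
        have := hw z (Ne.symm hne)
        omega
      · rw [((wordProd_filter hg z).2 hz).2.2, hiw]
    refine absurd (hmin _ hw') (not_le.2 (List.length_filter_lt_length_iff_exists.2 ⟨x, hx, ?_⟩))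
    simp only [decide_eq_true_eq]
    omega
  · by_contra! h
    obtain ⟨g, hg, h1, h2⟩ := exists_not_mem_word i b
    have hw' : wordProd (i.filter (· < g)) = w := by
      ext z
      rcases le_or_gt z g with hz | hz
      · rw [((wordProd_filter hg z).1 hz).2.1, hiw]
      · rw [((wordProd_filter hg z).2 hz).2.1]
        by_contra hne
        have := hw z (Ne.symm hne)
        omega
    refine absurd (hmin _ hw') (not_le.2 (List.length_filter_lt_length_iff_exists.2 ⟨x, hx, ?_⟩))
    simp only [decide_eq_true_eq]
    omega

theorem finite_words (k : ℕ) (s : Set ℤ) (hs : s.Finite) :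
    {i : List ℤ | i.length = k ∧ ∀ x ∈ i, x ∈ s}.Finite := by
  refine ((Set.Finite.pi' (fun _ : Fin k => hs)).image List.ofFn).subset ?_
  rintro i ⟨rfl, hi⟩
  exact ⟨i.get, fun j => hi _ (List.get_mem i j), List.ofFn_get i⟩

theorem finite_red {w : Equiv.Perm ℤ} (hw : {x | w x ≠ x}.Finite) : (Red w).Finite := by
  obtain ⟨a, ha⟩ := hw.bddBelow
  obtain ⟨b, hb⟩ := hw.bddAbove
  by_cases hne : (Red w).Nonempty
  · obtain ⟨i₀, h₀⟩ := hne
    refine (finite_words i₀.length _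
      (Set.finite_Icc (a - i₀.length - 1) (b + i₀.length))).subset fun i hi => ?_
    have hlen : i.length = i₀.length := le_antisymm (hi.2 _ h₀.1) (h₀.2 _ hi.1)
    refine ⟨hlen, fun x hx => ?_⟩
    rw [← hlen]
    exact mem_Icc_of_mem_red (fun x hx => ⟨ha hx, hb hx⟩) hi hx
  · rw [Set.not_nonempty_iff_eq_empty.1 hne]
    exact Set.finite_empty

/-! ### Schubert polynomials as sums of forest polynomials -/

theorem redInj_eq_iUnion (w : Equiv.Perm ℤ) :
    RedInj w⁻¹ = ⋃ C ∈ classesOf w, C.words := by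
  ext W
  simp only [Set.mem_iUnion, exists_prop]
  constructor
  · exact fun h => ⟨_, ⟨W, h, rfl⟩, rfl⟩
  · rintro ⟨_, ⟨V, hV, rfl⟩, hW⟩
    exact mem_redInj_of_pSymbol_eq hV (OmegaClass.mem_words_iff.1 hW)

theorem pairwise_of_mem_redInj {w : Equiv.Perm ℤ} {W : InjWord} (hW : W ∈ RedInj w) :
    W.1.Pairwise fun a b => val a = val b → a < b := by
  obtain ⟨i, -, rfl⟩ := hW
  exact pairwise_relabelAux i []

theorem schubert_eq_sum {w : Equiv.Perm ℤ} (hfin : (Red w⁻¹).Finite) :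
    schubert w = ∑ᶠ C ∈ classesOf w, C.poly := by
  have hR : (RedInj w⁻¹).Finite := hfin.image _
  have hsub : ∀ C ∈ classesOf w, C.words ⊆ RedInj w⁻¹ := fun C hC => by
    rw [redInj_eq_iUnion]
    exact Set.subset_biUnion_of_mem hC
  have h1 : schubert w = ∑ᶠ W ∈ RedInj w⁻¹, slide (W.1.map val) := by
    rw [RedInj, finsum_mem_image relabel_injective.injOn]
    refine finsum_mem_congr rfl fun i _ => ?_
    rw [show (relabel i).1.map val = i from map_val_relabelAux i []]
  rw [h1, redInj_eq_iUnion, finsum_mem_biUnion]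
  · refine finsum_mem_congr rfl fun C hC => ?_
    exact (C.poly_eq (hR.subset (hsub C hC))
      fun W hW => pairwise_of_mem_redInj (hsub C hC hW)).symm
  · intro C _ D _ hCD
    refine Set.disjoint_left.2 fun W hW hW' => hCD ?_
    exact Eq.trans (Eq.symm hW) hW'
  · exact hR.image _
  · exact fun C hC => hR.subset (hsub C hC)

theorem OmegaClass.isIndexedForest_shape (C : OmegaClass) : IsIndexedForest C.symbol.shape :=
  ForestSchubert.isIndexedForest_shape C.isSymbol.1

/-- The forests of the classes in `𝒢_w` with nonpositive support do not contribute. -/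
theorem exists_schubert_eq_sum_forestPoly {w : Equiv.Perm ℤ} (hfin : (Red w⁻¹).Finite) :
    ∃ c : IndexedForest →₀ ℕ, (∀ F ∈ c.support, F.IsPositive) ∧
      schubert w = c.sum fun F m => m • forestPoly F.1 := by
  classical
  have hG : (classesOf w).Finite := (hfin.image _).image _
  let sh : OmegaClass → IndexedForest := fun C => ⟨C.symbol.shape, C.isIndexedForest_shape⟩
  refine ⟨∑ C ∈ hG.toFinset.filter fun C => (sh C).IsPositive, Finsupp.single (sh C) 1,
    fun F hF => ?_, ?_⟩
  · obtain ⟨C, hC, hF⟩ := Finset.mem_biUnion.1 (Finsupp.support_finsetSum hF)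
    rw [Finset.mem_singleton.1 (Finsupp.support_single_subset hF)]
    exact (Finset.mem_filter.1 hC).2
  · rw [schubert_eq_sum hfin, finsum_mem_eq_finite_toFinset_sum _ hG,
      ← Finsupp.sum_finsetSum_index (h := fun (F : IndexedForest) (m : ℕ) => m • forestPoly F.1)
        (fun _ => zero_smul ..) (fun _ _ _ => add_smul ..),
      Finset.sum_filter]
    refine Finset.sum_congr rfl fun C _ => ?_
    have e : (Finsupp.single (sh C) 1).sum (fun F m => m • forestPoly F.1) =
        forestPoly (sh C).1 := by
      refine (Finsupp.sum_single_index ?_).trans (one_smul ..)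
      exact zero_smul ..
    rw [C.poly_eq_forestPoly, e]
    split_ifs with h
    · rfl
    · unfold IndexedForest.IsPositive at h
      push Not at h
      obtain ⟨p, hp, hp1⟩ := h
      exact forestPoly_eq_zero C.isIndexedForest_shape hp hp1

theorem finite_red_inv {w : Equiv.Perm ℤ} (hw : w ∈ SPlus) : (Red w⁻¹).Finite :=
  finite_red (hw.1.subset fun _ hx h => hx (Equiv.Perm.inv_eq_iff_eq.2 h.symm))

end ForestSchubert

theorem theorem1p3 (w : Equiv.Perm ℤ) (hw : w ∈ ForestSchubert.SPlus) :
    -- the sums below are finite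
    (ForestSchubert.Red w⁻¹).Finite ∧
    -- `Red(w⁻¹)` is a union of equivalence classes, namely of those in `𝒢_w`
    ForestSchubert.RedInj w⁻¹ = ⋃ C ∈ ForestSchubert.classesOf w, C.words ∧
    -- the Schubert polynomial is the sum over `𝒢_w` of the polynomials of the classes
    ForestSchubert.schubert w = ∑ᶠ C ∈ ForestSchubert.classesOf w, C.poly ∧
    -- the polynomial of a class is the forest polynomial of the shape of its `P`-symbol
    (∀ C ∈ ForestSchubert.classesOf w,
      ForestSchubert.IsIndexedForest C.symbol.shape ∧
      C.poly = ForestSchubert.forestPoly C.symbol.shape) ∧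
    -- hence the Schubert polynomial is a nonnegative combination of forest polynomials
    ∃ c : ForestSchubert.IndexedForest →₀ ℕ,
      (∀ F ∈ c.support, F.IsPositive) ∧
      ForestSchubert.schubert w = c.sum fun F m => m • ForestSchubert.forestPoly F.1 := by
  have hfin := ForestSchubert.finite_red_inv hw
  exact ⟨hfin, ForestSchubert.redInj_eq_iUnion w, ForestSchubert.schubert_eq_sum hfin,
    fun C _ => ⟨C.isIndexedForest_shape, C.poly_eq_forestPoly⟩,
    ForestSchubert.exists_schubert_eq_sum_forestPoly hfin⟩
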